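/- Let $\mathcal H$ be a separable real Hilbert space and let $\rho$ be a probability measure on $\mathcal H\times\mathbb R$ with marginal $\rho_{\mathcal H}$ on $\mathcal H$ and conditional distributions $\rho(\cdot\mid x)$ on $\mathbb R$. Assume that there are $M,\kappa\in\,]0,+\infty[$ with $|y|\le M$ $\rho$-almost surely and $\|x\|^2\le\kappa$ $\rho_{\mathcal H}$-almost surely. Let $\mathcal E(w)=\int(\langle w,x\rangle-y)^2\,d\rho(x,y)$ for $w\in\mathcal H$, let $\mathcal O\subset\mathcal H$ be the set of minimizers of $\mathcal E$ on $\mathcal H$, and let $w^\dagger$ be the element of minimal norm of $\mathcal O$. Let $f_\rho(x)=\int y\,d\rho(y\mid x)$, let $\overline{\mathcal L}_\rho$ be the closure in $L^2(\mathcal H,\rho_{\mathcal H})$ of $\mathcal L_\rho=\{\langle w,\cdot\rangle : w\in\mathcal H\}$, let $g_\rho=\operatorname{argmin}_{f\in\overline{\mathcal L}_\rho}\|f_\rho-f\|_\rho$, where $\|\cdot\|_\rho$ is the norm of $L^2(\mathcal H,\rho_{\mathcal H})$, and let $L$ be the positive compact operator $Lf(x)=\int\langle x,x'\rangle f(x')\,d\rho_{\mathcal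 H}(x')$ on $L^2(\mathcal H,\rho_{\mathcal H})$. Assume the source condition $g_\rho=L^rg$ for some $r\in\,]1/2,+\infty[$ and some $g\in L^2(\mathcal H,\rho_{\mathcal H})$, and let $\gamma\in\,]0,\kappa^{-1}]$. For $n\ge1$ and $n$ independent pairs $(x_1,y_1),\dots,(x_n,y_n)$ with law $\rho$, let $\hat w_0=0$ and, for $t\in\mathbb N$, let $\hat w_{t+1}=\hat u^n_t$, where $\hat u^0_t=\hat w_t$ and $\hat u^i_t=\hat u^{i-1}_t-\frac{\gamma}{n}\big(\langle\hat u^{i-1}_t,x_i\rangle-y_i\big)x_i$ for $i=1,\dots,n$. Then $\mathcal O\ne\varnothing$ and $w^\dagger$ is well defined (it exists and is unique). Moreover, for every $n\ge1$ and every $\delta\in\,]0,1[$: (i) for every integer $t\ge1$, with probability greater than $1-\delta$, $$\|\hat w_t-w^\dagger\|\le\frac{32\log(16/\delta)}{\sqrt n}\Big(M\kappa^{-1/2}+2M^2\kappa^{-1}+3\|g\|_\rho\,\kappa^{r-3/2}\Big)\,t+\Big(\frac{r-1/2}{\gamma}\Big)^{r-1/2}\|g\|_\rho\,t^{1/2-r};$$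 (ii) for the stopping rule $t^*(n)=\big\lceil n^{1/(2r+1)}\big\rceil$, with probability greater than $1-\delta$, $$\|\hat w_{t^*(n)}-w^\dagger\|\le\Big[32\log(16/\delta)\Big(M\kappa^{-1/2}+2M^2\kappa^{-1}+3\|g\|_\rho\,\kappa^{r-3/2}\Big)+\Big(\frac{r-1/2}{\gamma}\Big)^{r-1/2}\|g\|_\rho\Big]\,n^{-\frac{r-1/2}{2r+1}}.$$ -/

import Mathlib

open MeasureTheory ProbabilityTheory
open scoped RealInnerProductSpace

namespace IncReg

section Algorithm

variable {H : Type*} [NormedAddCommGroup H] [InnerProductSpace ℝ H]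

/-- One epoch of the incremental gradient iteration on the data `z`, started at `u`: the last point
of `û⁰ = u`, `ûⁱ = ûⁱ⁻¹ - (γ / n) (⟪ûⁱ⁻¹, xᵢ⟫ - yᵢ) xᵢ`, `i = 1, …, n`, where `zᵢ = (xᵢ, yᵢ)`. -/
noncomputable def epoch (γ : ℝ) {n : ℕ} (z : Fin n → H × ℝ) (u : H) : H :=
  Fin.foldl n
    (fun v i => v - (γ / (n : ℝ)) • ((⟪v, (z i).1⟫ - (z i).2) • (z i).1)) u

/-- The iterates `ŵ_t` of incremental iterative regularization: `ŵ_0 = w₀`, and `ŵ_{t+1}` is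
obtained from `ŵ_t` by one epoch over the data. -/
noncomputable def iterate (γ : ℝ) {n : ℕ} (z : Fin n → H × ℝ) (w₀ : H) : ℕ → H
  | 0 => w₀
  | t + 1 => epoch γ z (iterate γ z w₀ t)

end Algorithm

section FractionalPower

variable {E : Type*} [NormedAddCommGroup E] [InnerProductSpace ℝ E] [CompleteSpace E]

instance instCompleteSpaceEigenspace (A : E →L[ℝ] E) (σ : ℝ) :
    CompleteSpace (Module.End.eigenspace (A : E →ₗ[ℝ] E) σ) :=
  (ContinuousLinearMap.isClosed_eigenspace A σ).completeSpace_coe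

/-- `IsFractionalPower A r f h` says `h = A ^ r f`, for `A` positive, self-adjoint and compact:
`h = ∑ σ, σ ^ r • P_σ f`, with `P_σ` the orthogonal projection onto the eigenspace `ker (A - σ)`
(which is zero unless `σ` is an eigenvalue). -/
def IsFractionalPower (A : E →L[ℝ] E) (r : ℝ) (f h : E) : Prop :=
  HasSum (fun σ : ℝ => σ ^ r • (Module.End.eigenspace (A : E →ₗ[ℝ] E) σ).starProjection f) h

end FractionalPower

section Risk

variable {H : Type*} [NormedAddCommGroup H] [InnerProductSpace ℝ H] [MeasurableSpace H]

/-- The expected risk `ℰ(w) = ∫ (⟪w, x⟫ - y)² dρ(x, y)`. -/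
noncomputable def risk (ρ : Measure (H × ℝ)) (w : H) : ℝ :=
  ∫ z, (⟪w, z.1⟫ - z.2) ^ 2 ∂ρ

/-- The set `𝒪` of minimizers of the risk on `H`. -/
def riskMinimizers (ρ : Measure (H × ℝ)) : Set H :=
  {w | ∀ v, risk ρ w ≤ risk ρ v}

/-- `w` is a minimizer of the risk of minimal norm. -/
def IsMinNormMinimizer (ρ : Measure (H × ℝ)) (w : H) : Prop :=
  w ∈ riskMinimizers ρ ∧ ∀ v ∈ riskMinimizers ρ, ‖w‖ ≤ ‖v‖

/-- The boundedness assumption: `|y| ≤ M` and `‖x‖² ≤ κ` almost surely. -/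
structure BoundedData (ρ : Measure (H × ℝ)) (M κ : ℝ) : Prop where
  M_pos : 0 < M
  κ_pos : 0 < κ
  abs_le : ∀ᵐ z ∂ρ, |z.2| ≤ M
  norm_sq_le : ∀ᵐ x ∂ρ.fst, ‖x‖ ^ 2 ≤ κ

/-- The regression function `f_ρ(x) = ∫ y dρ(y | x)`. -/
noncomputable def regressionFun (ρ : Measure (H × ℝ)) [IsFiniteMeasure ρ] (x : H) : ℝ :=
  ∫ y, y ∂(ρ.condKernel x)

/-- The set `ℒ_ρ` of the elements of `L²(H, ρ_H)` of the form `⟪w, ·⟫` with `w ∈ H`. -/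
def linearFunctions (ρ : Measure (H × ℝ)) : Set (Lp ℝ 2 ρ.fst) :=
  {f | ∃ w : H, f =ᵐ[ρ.fst] fun x => ⟪w, x⟫}

variable {ρ : Measure (H × ℝ)} {M κ : ℝ}

set_option linter.unusedSectionVars false in
theorem BoundedData.memLp_regressionFun [IsProbabilityMeasure ρ] (h : BoundedData ρ M κ) :
    MemLp (regressionFun ρ) 2 ρ.fst := by
  have hm : StronglyMeasurable (regressionFun ρ) :=
    StronglyMeasurable.integral_kernel_prod_right' (κ := ρ.condKernel) (f := fun z : H × ℝ => z.2)
      measurable_snd.stronglyMeasurable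
  refine MemLp.of_bound hm.aestronglyMeasurable M ?_
  have h1 : ∀ᵐ z ∂(ρ.fst ⊗ₘ ρ.condKernel), |z.2| ≤ M := by
    rw [ρ.disintegrate]; exact h.abs_le
  filter_upwards [Measure.ae_ae_of_ae_compProd h1] with x hx
  have := norm_integral_le_of_norm_le_const (μ := ρ.condKernel x) (f := fun y : ℝ => y) (C := M)
    (by simpa [Real.norm_eq_abs] using hx)
  simpa [regressionFun] using this

/-- The regression function as an element of `L²(H, ρ_H)`. -/
noncomputable def regressionLp [IsProbabilityMeasure ρ] (h : BoundedData ρ M κ) :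
    Lp ℝ 2 ρ.fst :=
  h.memLp_regressionFun.toLp (regressionFun ρ)

variable [BorelSpace H] [SecondCountableTopology H]

theorem BoundedData.memLp_inner [IsProbabilityMeasure ρ] (h : BoundedData ρ M κ) (w : H) :
    MemLp (fun x : H => ⟪w, x⟫) 2 ρ.fst := by
  refine MemLp.of_bound (by fun_prop) (‖w‖ * √κ) ?_
  filter_upwards [h.norm_sq_le] with x hx
  exact (norm_inner_le_norm w x).trans
    (mul_le_mul_of_nonneg_left (Real.le_sqrt_of_sq_le hx) (norm_nonneg w))

theorem BoundedData.norm_toLp_inner_le [IsProbabilityMeasure ρ] (h : BoundedData ρ M κ) (w : H) :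
    ‖(h.memLp_inner w).toLp‖ ≤ √κ * ‖w‖ := by
  have := Lp.norm_le_of_ae_bound (p := 2) (f := (h.memLp_inner w).toLp) (C := √κ * ‖w‖)
    (by positivity) (by
      filter_upwards [h.norm_sq_le, (h.memLp_inner w).coeFn_toLp] with x hx hx'
      rw [hx', mul_comm]
      exact (norm_inner_le_norm w x).trans
        (mul_le_mul_of_nonneg_left (Real.le_sqrt_of_sq_le hx) (norm_nonneg w)))
  simpa [measureUnivNNReal] using this

/-- The inclusion `S : H → L²(H, ρ_H)`, `w ↦ ⟪w, ·⟫`. -/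
noncomputable def inclusion [IsProbabilityMeasure ρ] (h : BoundedData ρ M κ) :
    H →L[ℝ] Lp ℝ 2 ρ.fst :=
  LinearMap.mkContinuous
    { toFun := fun w => (h.memLp_inner w).toLp
      map_add' := fun v w => by
        rw [← MemLp.toLp_add]
        exact MemLp.toLp_congr _ _ (.of_forall fun x => by simp [inner_add_left])
      map_smul' := fun c w => by
        rw [RingHom.id_apply, ← MemLp.toLp_const_smul]
        exact MemLp.toLp_congr _ _ (.of_forall fun x => by simp [inner_smul_left]) }
    √κ h.norm_toLp_inner_le

variable [CompleteSpace H]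

/-- `S S* f` is represented by `x ↦ ∫ ⟪x, x'⟫ f(x') dρ_H(x')`. -/
theorem inclusion_adjoint_ae [IsProbabilityMeasure ρ] (h : BoundedData ρ M κ)
    (f : Lp ℝ 2 ρ.fst) :
    inclusion h ((inclusion h).adjoint f) =ᵐ[ρ.fst] fun x => ∫ x', ⟪x, x'⟫ * f x' ∂ρ.fst := by
  filter_upwards [(h.memLp_inner ((inclusion h).adjoint f)).coeFn_toLp] with x hx
  refine hx.trans ?_
  rw [ContinuousLinearMap.adjoint_inner_left, real_inner_comm, L2.inner_def]
  refine integral_congr_ae ?_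
  filter_upwards [(h.memLp_inner x).coeFn_toLp] with x' hx'
  change f x' * (h.memLp_inner x).toLp (fun x' => ⟪x, x'⟫) x' = _
  rw [hx', mul_comm]

theorem memLp_integralOp [IsProbabilityMeasure ρ] (h : BoundedData ρ M κ) (f : Lp ℝ 2 ρ.fst) :
    MemLp (fun x : H => ∫ x', ⟪x, x'⟫ * f x' ∂ρ.fst) 2 ρ.fst :=
  (Lp.memLp _).ae_eq (inclusion_adjoint_ae h f)

theorem toLp_integralOp [IsProbabilityMeasure ρ] (h : BoundedData ρ M κ) (f : Lp ℝ 2 ρ.fst) :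
    (memLp_integralOp h f).toLp = inclusion h ((inclusion h).adjoint f) :=
  Lp.ext ((memLp_integralOp h f).coeFn_toLp.trans (inclusion_adjoint_ae h f).symm)

/-- The integral operator `L : L²(H, ρ_H) → L²(H, ρ_H)`,
`(L f)(x) = ∫ ⟪x, x'⟫ f(x') dρ_H(x')`. -/
noncomputable def integralOp [IsProbabilityMeasure ρ] (h : BoundedData ρ M κ) :
    Lp ℝ 2 ρ.fst →L[ℝ] Lp ℝ 2 ρ.fst :=
  LinearMap.mkContinuous
    { toFun := fun f => (memLp_integralOp h f).toLp (fun x => ∫ x', ⟪x, x'⟫ * f x' ∂ρ.fst)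
      map_add' := fun f g => by
        rw [toLp_integralOp h, toLp_integralOp h, toLp_integralOp h, map_add, map_add]
      map_smul' := fun c f => by
        rw [toLp_integralOp h, toLp_integralOp h, map_smul, map_smul, RingHom.id_apply] }
    ‖(inclusion h).comp (inclusion h).adjoint‖ fun f => by
      change ‖(memLp_integralOp h f).toLp‖ ≤ _
      rw [toLp_integralOp]
      exact ((inclusion h).comp (inclusion h).adjoint).le_opNorm f

/-- The source condition `g_ρ = L ^ r g`, where `g_ρ` is the point of the closure of `ℒ_ρ` in
`L²(H, ρ_H)` that is nearest to the regression function `f_ρ`. -/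
def SourceCondition [IsProbabilityMeasure ρ] (h : BoundedData ρ M κ) (r : ℝ)
    (g : Lp ℝ 2 ρ.fst) : Prop :=
  ∃ gρ ∈ closure (linearFunctions ρ),
    (∀ f ∈ closure (linearFunctions ρ), ‖regressionLp h - gρ‖ ≤ ‖regressionLp h - f‖) ∧
    IsFractionalPower (integralOp h) r g gρ

end Risk

end IncReg

/-!
Let `η = γ / n`. The iterates are compared with gradient descent `u₀ = 0`,
`u_{k+1} = u_k - η ∇ℰ(u_k) / 2` on the risk (`riskDescent`): after `t` passes over the data,
`ŵ_t` is close to `u_{nt}`, which is close to `w†`.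

*Bias.* Let `S : H → L²` be the inclusion, so that `L = S S*`. The source condition makes
`w₀ = ∑ σ, σ ^ (r - 1) • S* P_σ g` converge to a point with `S w₀ = g_ρ` and `w₀ ⟂ ker S`
(`exists_preimage_of_isFractionalPower`). Hence `w₀` is the minimizer of minimal norm, and
`u_k - w₀ = -(1 - η S* S) ^ k w₀` is a sum of orthogonal eigenvectors of `S* S`, whose size is
governed by `sup σ, (1 - η σ) ^ k σ ^ (r - 1 / 2) ≤ ((r - 1 / 2) / (η k)) ^ (r - 1 / 2)`
(`SourceCondition.exists_minNormMinimizer`).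

*Variance.* A pass over the data is a nonexpansive map, so `‖ŵ_t - u_{nt}‖` is at most the sum over
`s < t` of the errors made by single passes started at `u_{ns}`
(`norm_iterate_sub_riskDescent_le`). Such an error is the end point of a recursion
`e ↦ (1 - η x ⊗ x) e + ξ` with independent centred noise `ξ` (`affineFold_gradNoise`), a martingale
in reversed time. Its exponential moments follow from a second-order expansion of `cosh ‖·‖`
(`integral_cosh_norm_affineFold_le`). The variance of the noise is at most `η² κ ℰ(u_k) ≤ η² κ M²`,
because the risk decreases along gradient descent, and its size is at most of order
`η √κ M √t`, because `‖u_k‖² ≤ γ t M²` for `k ≤ n t`. If `16 t ≤ n`, convexity over `s < t` and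
Markov's inequality bound the sum by `γ √κ M log (16 / δ) t / √n` with probability greater than
`1 - δ`. If `16 t > n`, the deterministic bounds `‖ŵ_t‖², ‖u_{nt}‖² ≤ γ t M²` suffice
(`BoundedData.prob_variance_le`).

Only the summand `M κ ^ (-1 / 2)` of the constant and half of the factor `32` are needed at a fixed
time; the other half absorbs the rounding `⌈s⌉ ≤ 2 s` in the stopping rule.
-/

namespace IncReg

/-! ### Exponential moments of products of contractions -/

/-- The function `q ↦ cosh √q` is convex: its power series has nonnegative coefficients. -/
theorem cosh_le_convex_combination {θ s u v : ℝ} (h0 : 0 ≤ θ) (h1 : θ ≤ 1)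
    (h : s ^ 2 = θ * u ^ 2 + (1 - θ) * v ^ 2) :
    Real.cosh s ≤ θ * Real.cosh u + (1 - θ) * Real.cosh v := by
  refine hasSum_le (fun k => ?_) (Real.hasSum_cosh s)
    (((Real.hasSum_cosh u).mul_left θ).add ((Real.hasSum_cosh v).mul_left (1 - θ)))
  have hc := (convexOn_pow (𝕜 := ℝ) k).2 (Set.mem_Ici.2 (sq_nonneg u))
    (Set.mem_Ici.2 (sq_nonneg v)) h0 (sub_nonneg.2 h1) (by ring)
  simp only [smul_eq_mul] at hc
  rw [pow_mul, pow_mul, pow_mul, h, mul_div_assoc', mul_div_assoc', ← add_div]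
  gcongr

theorem cosh_add_le (a c : ℝ) (hc : 0 ≤ c) :
    Real.cosh (a + c) ≤
      Real.cosh a + Real.sinh a * c + Real.cosh a * (Real.exp c - 1 - c) := by
  have h1 : Real.sinh a ≤ Real.cosh a := (Real.sinh_lt_cosh a).le
  have h2 : c ≤ Real.sinh c := Real.self_le_sinh_iff.2 hc
  rw [Real.cosh_add, ← Real.cosh_add_sinh c]
  nlinarith [mul_nonneg (sub_nonneg.2 h1) (sub_nonneg.2 h2)]

section Fold

variable {H : Type*} [NormedAddCommGroup H] [InnerProductSpace ℝ H]

/-- A second-order expansion of `cosh ‖·‖` around `x`, the substitute in a Hilbert space for the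
inequality `exp d ≤ 1 + d + (exp |d| - 1 - |d|)` on the line. -/
theorem cosh_norm_add_le (x d : H) :
    Real.cosh ‖x + d‖ ≤ Real.cosh ‖x‖ + Real.sinh ‖x‖ / ‖x‖ * ⟪x, d⟫
      + Real.cosh ‖x‖ * (Real.exp ‖d‖ - 1 - ‖d‖) := by
  rcases eq_or_ne x 0 with rfl | hx
  · simpa using cosh_add_le 0 ‖d‖ (norm_nonneg d)
  rcases eq_or_ne d 0 with rfl | hd
  · simp
  set a := ‖x‖
  set c := ‖d‖
  have ha : 0 < a := norm_pos_iff.2 hx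
  have hc : 0 < c := norm_pos_iff.2 hd
  have hp := abs_le.1 (abs_real_inner_le_norm x d)
  set p := ⟪x, d⟫
  -- both sides are compared along `p ↦ ‖x + d‖² = a² + 2 p + c²`, `p ∈ [-a c, a c]`: the left side
  -- is convex in `p` and the right side affine, so the end points `p = ± a c` suffice
  have key : Real.cosh ‖x + d‖ ≤ (p + a * c) / (2 * (a * c)) * Real.cosh (a + c)
      + (1 - (p + a * c) / (2 * (a * c))) * Real.cosh (a + -c) := by
    refine cosh_le_convex_combination ?_ ?_ ?_
    · exact div_nonneg (by linarith [hp.1]) (by positivity)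
    · rw [div_le_one (by positivity)]; linarith [hp.2]
    · rw [norm_add_sq_real]
      field_simp
      ring
  have hθ0 : 0 ≤ (p + a * c) / (2 * (a * c)) :=
    div_nonneg (by linarith [hp.1]) (by positivity)
  have hθ1 : 0 ≤ 1 - (p + a * c) / (2 * (a * c)) := by
    rw [sub_nonneg, div_le_one (by positivity)]; linarith [hp.2]
  have e1 := cosh_add_le a c hc.le
  have e2 : Real.cosh (a + -c) ≤
      Real.cosh a - Real.sinh a * c + Real.cosh a * (Real.exp c - 1 - c) := by
    have := cosh_add_le (-a) c hc.le
    rw [Real.cosh_neg, Real.sinh_neg, ← Real.cosh_neg] at this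
    simpa [sub_eq_add_neg, add_comm] using this
  refine key.trans ((add_le_add (mul_le_mul_of_nonneg_left e1 hθ0)
    (mul_le_mul_of_nonneg_left e2 hθ1)).trans (le_of_eq ?_))
  field_simp
  ring

variable {Z : Type*}

/-- The last point of the recursion `v ↦ A (zᵢ) v + ξᵢ (zᵢ)`, `i = 0, …, n - 1`, started at `v`. -/
noncomputable def affineFold (A : Z → H →L[ℝ] H) {n : ℕ} (ξ : Fin n → Z → H) (z : Fin n → Z)
    (v : H) : H :=
  Fin.foldl n (fun v i => A (z i) v + ξ i (z i)) v

theorem affineFold_succ (A : Z → H →L[ℝ] H) {n : ℕ} (ξ : Fin (n + 1) → Z → H)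
    (z : Fin (n + 1) → Z) (v : H) :
    affineFold A ξ z v =
      affineFold A (fun i => ξ i.succ) (fun i => z i.succ) (A (z 0) v + ξ 0 (z 0)) := by
  simp [affineFold, Fin.foldl_succ]

/-- The affine recursion depends on its starting point through a linear contraction. -/
theorem exists_affineFold_eq {A : Z → H →L[ℝ] H} (hA : ∀ z, ‖A z‖ ≤ 1) {n : ℕ}
    (ξ : Fin n → Z → H) (z : Fin n → Z) :
    ∃ Q : H →L[ℝ] H, ‖Q‖ ≤ 1 ∧ ∀ v, affineFold A ξ z v = affineFold A ξ z 0 + Q v := by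
  induction n with
  | zero => exact ⟨.id ℝ H, ContinuousLinearMap.norm_id_le, fun v => by simp [affineFold]⟩
  | succ n ih =>
    obtain ⟨Q, hQ, h⟩ := ih (fun i => ξ i.succ) (fun i => z i.succ)
    refine ⟨Q.comp (A (z 0)), (Q.opNorm_comp_le _).trans
      (mul_le_one₀ hQ (norm_nonneg _) (hA _)), fun v => ?_⟩
    rw [affineFold_succ, affineFold_succ, h, h (A (z 0) 0 + _)]
    simp only [map_add, map_zero, zero_add, ContinuousLinearMap.comp_apply]
    abel

theorem norm_affineFold_le {A : Z → H →L[ℝ] H} (hA : ∀ z, ‖A z‖ ≤ 1) {n : ℕ}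
    {ξ : Fin n → Z → H} (hξ : ∀ i z, ‖ξ i z‖ ≤ 1) (z : Fin n → Z) :
    ‖affineFold A ξ z 0‖ ≤ n := by
  induction n with
  | zero => simp [affineFold]
  | succ n ih =>
    obtain ⟨Q, hQ, h⟩ := exists_affineFold_eq hA (fun i => ξ i.succ) (fun i => z i.succ)
    rw [affineFold_succ, h]
    refine (norm_add_le _ _).trans ?_
    push_cast
    refine add_le_add (ih (fun i z => hξ _ z) _) ?_
    simpa using Q.le_of_opNorm_le_of_le hQ (hξ 0 (z 0))

variable [MeasurableSpace Z] [MeasurableSpace H] [BorelSpace H] [SecondCountableTopology H]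

theorem measurable_affineFold {A : Z → H →L[ℝ] H}
    (hAm : Measurable fun p : Z × H => A p.1 p.2) {n : ℕ} {ξ : Fin n → Z → H}
    (hξm : ∀ i, Measurable (ξ i)) :
    Measurable fun p : (Fin n → Z) × H => affineFold A ξ p.1 p.2 := by
  induction n with
  | zero => simpa [affineFold] using measurable_snd
  | succ n ih =>
    simp_rw [affineFold_succ]
    have h1 : Measurable fun p : (Fin (n + 1) → Z) × H =>
        ((fun i : Fin n => p.1 i.succ), A (p.1 0) p.2 + ξ 0 (p.1 0)) := by
      refine Measurable.prodMk (by fun_prop) ?_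
      exact (hAm.comp (f := fun p : (Fin (n + 1) → Z) × H => (p.1 0, p.2)) (by fun_prop)).add
        ((hξm 0).comp (by fun_prop))
    exact (ih fun i => hξm i.succ).comp h1

theorem integrable_cosh_norm_affineFold {A : Z → H →L[ℝ] H} (hA : ∀ z, ‖A z‖ ≤ 1)
    (hAm : Measurable fun p : Z × H => A p.1 p.2) {n : ℕ} {ξ : Fin n → Z → H}
    (hξm : ∀ i, Measurable (ξ i)) (hξ : ∀ i z, ‖ξ i z‖ ≤ 1) (ν : Measure (Fin n → Z))
    [IsFiniteMeasure ν] :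
    Integrable (fun z => Real.cosh ‖affineFold A ξ z 0‖) ν := by
  have hm : Measurable fun z : Fin n → Z => affineFold A ξ z 0 :=
    (measurable_affineFold hAm hξm).comp (measurable_id.prodMk measurable_const)
  refine .of_bound (Real.continuous_cosh.measurable.comp hm.norm).aestronglyMeasurable
    (Real.cosh n) (.of_forall fun z => ?_)
  rw [Real.norm_of_nonneg (Real.cosh_pos _).le, Real.cosh_le_cosh, abs_norm, Nat.abs_cast]
  exact norm_affineFold_le hA hξ z

variable [CompleteSpace H]

theorem integral_cosh_norm_add_le (μ : Measure Z) [IsProbabilityMeasure μ] {ζ : Z → H}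
    (hm : Measurable ζ) (hb : ∀ z, ‖ζ z‖ ≤ 1) (h0 : ∫ z, ζ z ∂μ = 0) {v : ℝ}
    (hv : ∫ z, ‖ζ z‖ ^ 2 ∂μ ≤ v) {Q : H →L[ℝ] H} (hQ : ‖Q‖ ≤ 1) (x : H) :
    ∫ z, Real.cosh ‖x + Q (ζ z)‖ ∂μ ≤ (1 + v) * Real.cosh ‖x‖ := by
  have hζ : Integrable ζ μ := .of_bound hm.aestronglyMeasurable 1 (.of_forall hb)
  have hζ2 : Integrable (fun z => ‖ζ z‖ ^ 2) μ :=
    .of_bound (by fun_prop) 1 (.of_forall fun z => by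
      simpa using hb z)
  have hQζ : ∀ z, ‖Q (ζ z)‖ ≤ ‖ζ z‖ := fun z => by simpa using Q.le_of_opNorm_le hQ (ζ z)
  have hin : Integrable (fun z => ⟪x, Q (ζ z)⟫) μ := (Q.integrable_comp hζ).const_inner x
  have hin0 : ∫ z, ⟪x, Q (ζ z)⟫ ∂μ = 0 := by
    rw [integral_inner (Q.integrable_comp hζ), Q.integral_comp_comm hζ, h0, map_zero,
      inner_zero_right]
  have hi : Integrable
      (fun z => Real.cosh ‖x‖ + Real.sinh ‖x‖ / ‖x‖ * ⟪x, Q (ζ z)⟫) μ :=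
    (integrable_const _).add (hin.const_mul _)
  calc ∫ z, Real.cosh ‖x + Q (ζ z)‖ ∂μ
      ≤ ∫ z, ((Real.cosh ‖x‖ + Real.sinh ‖x‖ / ‖x‖ * ⟪x, Q (ζ z)⟫)
        + Real.cosh ‖x‖ * ‖ζ z‖ ^ 2) ∂μ := by
        refine integral_mono_of_nonneg (.of_forall fun z => (Real.cosh_pos _).le)
          (hi.add (hζ2.const_mul _))
          (.of_forall fun z => (cosh_norm_add_le _ _).trans ?_)
        have h1 := Real.abs_exp_sub_one_sub_id_le (x := ‖Q (ζ z)‖) (by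
          rw [abs_norm]; exact (hQζ z).trans (hb z))
        have h2 := (le_abs_self _).trans (h1.trans (pow_le_pow_left₀ (norm_nonneg _) (hQζ z) 2))
        have := mul_le_mul_of_nonneg_left h2 (Real.cosh_pos ‖x‖).le
        simpa using this
    _ = Real.cosh ‖x‖ + Real.cosh ‖x‖ * ∫ z, ‖ζ z‖ ^ 2 ∂μ := by
        rw [integral_add hi (hζ2.const_mul _),
          integral_add (integrable_const _) (hin.const_mul _), integral_const_mul,
          integral_const_mul, hin0]
        simp
    _ ≤ _ := by nlinarith [Real.cosh_pos ‖x‖]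

/-- Exponential moments of the affine recursion driven by independent centred noise. Peeling off the
first variable, the noise it contributes is transported by a contraction that depends only on the
later variables, so that the partial sums form a martingale in reversed time. -/
theorem integral_cosh_norm_affineFold_le (μ : Measure Z) [IsProbabilityMeasure μ]
    {A : Z → H →L[ℝ] H} (hA : ∀ z, ‖A z‖ ≤ 1)
    (hAm : Measurable fun p : Z × H => A p.1 p.2) {v : ℝ} {n : ℕ} {ξ : Fin n → Z → H}
    (hξm : ∀ i, Measurable (ξ i)) (hξ : ∀ i z, ‖ξ i z‖ ≤ 1) (h0 : ∀ i, ∫ z, ξ i z ∂μ = 0)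
    (hv : ∀ i, ∫ z, ‖ξ i z‖ ^ 2 ∂μ ≤ v) (hv0 : 0 ≤ v) :
    ∫ z, Real.cosh ‖affineFold A ξ z 0‖ ∂(Measure.pi fun _ : Fin n => μ) ≤ (1 + v) ^ n := by
  induction n with
  | zero => simp [affineFold]
  | succ n ih =>
    have hmp := measurePreserving_piFinSuccAbove (fun _ : Fin (n + 1) => μ) 0
    let F : Z × (Fin n → Z) → ℝ := fun p =>
      Real.cosh ‖affineFold A (fun i => ξ i.succ) p.2 (ξ 0 p.1)‖
    have hF : ∀ z : Fin (n + 1) → Z, Real.cosh ‖affineFold A ξ z 0‖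
        = F (MeasurableEquiv.piFinSuccAbove (fun _ => Z) 0 z) := fun z => by
      simp only [F, affineFold_succ, map_zero, zero_add]
      rfl
    have hint : Integrable F (μ.prod (Measure.pi fun _ : Fin n => μ)) := by
      rw [← hmp.integrable_comp_emb (MeasurableEquiv.measurableEmbedding _)]
      refine (integrable_cosh_norm_affineFold hA hAm hξm hξ _).congr (.of_forall hF)
    calc ∫ z, Real.cosh ‖affineFold A ξ z 0‖ ∂(Measure.pi fun _ : Fin (n + 1) => μ)
        = ∫ p, F p ∂(μ.prod (Measure.pi fun _ : Fin n => μ)) := by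
          simp_rw [hF]
          exact hmp.integral_comp' F
      _ = ∫ z', ∫ z, F (z, z') ∂μ ∂(Measure.pi fun _ : Fin n => μ) :=
          integral_prod_symm F hint
      _ ≤ ∫ z', (1 + v) * Real.cosh ‖affineFold A (fun i => ξ i.succ) z' 0‖
            ∂(Measure.pi fun _ : Fin n => μ) := by
          refine integral_mono hint.integral_prod_right
            ((integrable_cosh_norm_affineFold hA hAm (fun i => hξm i.succ)
              (fun i => hξ i.succ) _).const_mul _) fun z' => ?_
          obtain ⟨Q, hQ, h⟩ := exists_affineFold_eq hA (fun i : Fin n => ξ i.succ) z'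
          simp only [F, h (ξ 0 _)]
          exact integral_cosh_norm_add_le μ (hξm 0) (hξ 0) (h0 0) (hv 0) hQ _
      _ ≤ (1 + v) ^ (n + 1) := by
          rw [integral_const_mul, pow_succ']
          exact mul_le_mul_of_nonneg_left (ih (fun i => hξm i.succ) (fun i => hξ i.succ)
            (fun i => h0 i.succ) fun i => hv i.succ) (by positivity)

end Fold

/-! ### Spectral consequences of the source condition -/

theorem rpow_mul_exp_neg_le {p x : ℝ} (hp : 0 < p) (hx : 0 ≤ x) :
    x ^ p * Real.exp (-x) ≤ p ^ p := by
  have h1 : x / p ≤ Real.exp (x / p) := by linarith [Real.add_one_le_exp (x / p)]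
  have h2 : x ≤ p * Real.exp (x / p) := by rwa [div_le_iff₀' hp] at h1
  have h3 : x ^ p ≤ p ^ p * Real.exp x := by
    refine (Real.rpow_le_rpow hx h2 hp.le).trans (le_of_eq ?_)
    rw [Real.mul_rpow hp.le (Real.exp_pos _).le, ← Real.exp_mul, div_mul_cancel₀ _ hp.ne']
  rwa [Real.exp_neg, ← div_eq_mul_inv, div_le_iff₀ (Real.exp_pos _)]

/-- The residual function of `k` steps of gradient descent, against the smoothness `p`. -/
theorem one_sub_pow_mul_rpow_le {η σ p : ℝ} {k : ℕ} (hη : 0 < η) (hσ : 0 ≤ σ) (h1 : η * σ ≤ 1)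
    (hp : 0 < p) (hk : 0 < k) :
    (1 - η * σ) ^ k * σ ^ p ≤ (p / (η * k)) ^ p := by
  have hk' : (0 : ℝ) < k := Nat.cast_pos.2 hk
  have e1 : (1 - η * σ) ^ k ≤ Real.exp (-(η * k * σ)) := by
    have := pow_le_pow_left₀ (sub_nonneg.2 h1) (Real.one_sub_le_exp_neg (η * σ)) k
    rw [← Real.exp_nat_mul] at this
    exact this.trans (le_of_eq (by congr 1; ring))
  refine (mul_le_mul_of_nonneg_right e1 (Real.rpow_nonneg hσ p)).trans ?_
  rw [Real.div_rpow hp.le (by positivity), le_div_iff₀ (by positivity)]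
  have := rpow_mul_exp_neg_le hp (x := η * k * σ) (by positivity)
  rw [Real.mul_rpow (by positivity) hσ] at this
  linarith

section Operator

open ContinuousLinearMap

variable {H E : Type*} [NormedAddCommGroup H] [InnerProductSpace ℝ H] [CompleteSpace H]
  [NormedAddCommGroup E] [InnerProductSpace ℝ E] [CompleteSpace E]

theorem norm_sq_adjoint_of_eigenvector {S : H →L[ℝ] E} {σ : ℝ} {q : E}
    (hq : S (S.adjoint q) = σ • q) : ‖S.adjoint q‖ ^ 2 = σ * ‖q‖ ^ 2 := by
  rw [← real_inner_self_eq_norm_sq, adjoint_inner_left, hq, inner_smul_right,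
    real_inner_self_eq_norm_sq]

theorem norm_sq_adjoint_apply_le {S : H →L[ℝ] E} {κ : ℝ} (hS : ‖S‖ ^ 2 ≤ κ) (q : E) :
    ‖S.adjoint q‖ ^ 2 ≤ κ * ‖q‖ ^ 2 := by
  have h1 := S.adjoint.le_opNorm q
  rw [LinearIsometryEquiv.norm_map] at h1
  calc _ ≤ (‖S‖ * ‖q‖) ^ 2 := pow_le_pow_left₀ (norm_nonneg _) h1 2
    _ ≤ _ := by rw [mul_pow]; gcongr

theorem eigenvalue_mem_Icc {S : H →L[ℝ] E} {κ σ : ℝ} (hS : ‖S‖ ^ 2 ≤ κ) {q : E}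
    (hq : S (S.adjoint q) = σ • q) (h0 : q ≠ 0) : 0 ≤ σ ∧ σ ≤ κ := by
  have h1 := norm_sq_adjoint_of_eigenvector hq
  have h2 := norm_sq_adjoint_apply_le hS q
  have h3 : 0 < ‖q‖ ^ 2 := by positivity
  constructor
  · by_contra! h
    nlinarith [sq_nonneg ‖S.adjoint q‖]
  · by_contra! h
    nlinarith

/-- Bessel's inequality for the eigenspaces of a symmetric operator. -/
theorem sum_norm_sq_starProjection_eigenspace_le {A : E →L[ℝ] E}
    (hA : (A : E →ₗ[ℝ] E).IsSymmetric) (g : E) (s : Finset ℝ) :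
    ∑ σ ∈ s, ‖(Module.End.eigenspace (A : E →ₗ[ℝ] E) σ).starProjection g‖ ^ 2 ≤ ‖g‖ ^ 2 := by
  set q : ℝ → E := fun σ => (Module.End.eigenspace (A : E →ₗ[ℝ] E) σ).starProjection g
  have h1 : ‖∑ σ ∈ s, q σ‖ ^ 2 = ∑ σ ∈ s, ‖q σ‖ ^ 2 :=
    hA.orthogonalFamily_eigenspaces.norm_sum
      (fun σ => (Module.End.eigenspace (A : E →ₗ[ℝ] E) σ).orthogonalProjectionOnto g) s
  have h2 : ⟪∑ σ ∈ s, q σ, g⟫ = ∑ σ ∈ s, ‖q σ‖ ^ 2 := by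
    rw [sum_inner]
    refine Finset.sum_congr rfl fun σ _ => ?_
    have := Submodule.inner_starProjection_left_eq_right
      (Module.End.eigenspace (A : E →ₗ[ℝ] E) σ) (q σ) g
    rw [← real_inner_self_eq_norm_sq]
    rw [Submodule.starProjection_eq_self_iff.2 (Submodule.starProjection_apply_mem _ _)] at this
    exact this
  have h3 := real_inner_le_norm (∑ σ ∈ s, q σ) g
  rw [h2, ← h1] at h3
  rw [← h1]
  nlinarith [norm_nonneg (∑ σ ∈ s, q σ), norm_nonneg g]

/-- If `S S* = A` and `f = A ^ r g` with `r > 1 / 2`, then `f = S w₀` for some `w₀ ⟂ ker S`, and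
gradient descent removes `w₀` at a polynomial rate. The point is `w₀ = ∑ σ, σ ^ (r - 1) • S* P_σ g`,
whose terms are pairwise orthogonal eigenvectors of `S* S` of norm `σ ^ (r - 1 / 2) ‖P_σ g‖`. -/
theorem exists_preimage_of_isFractionalPower {S : H →L[ℝ] E} {κ r : ℝ} (hκ : 0 < κ)
    (hS : ‖S‖ ^ 2 ≤ κ) (hr : 1 / 2 < r) {g f : E}
    (h : IsFractionalPower (S.comp S.adjoint) r g f) :
    ∃ w₀ : H, S w₀ = f ∧ (∀ v, S v = 0 → ⟪w₀, v⟫ = 0) ∧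
      ∀ η : ℝ, 0 < η → η * κ ≤ 1 → ∀ k : ℕ, 0 < k →
        ‖((.id ℝ H - η • S.adjoint.comp S : H →L[ℝ] H) ^ k) w₀‖
          ≤ ((r - 1 / 2) / (η * k)) ^ (r - 1 / 2) * ‖g‖ := by
  set A : E →L[ℝ] E := S.comp S.adjoint
  set T : H →L[ℝ] H := S.adjoint.comp S
  have hA : (A : E →ₗ[ℝ] E).IsSymmetric := fun x y => by
    change ⟪S (S.adjoint x), y⟫ = ⟪x, S (S.adjoint y)⟫
    exact (adjoint_inner_right S _ _).symm.trans (adjoint_inner_left S _ _)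
  have hT : (T : H →ₗ[ℝ] H).IsSymmetric := fun x y => by
    change ⟪S.adjoint (S x), y⟫ = ⟪x, S.adjoint (S y)⟫
    rw [adjoint_inner_left, adjoint_inner_right]
  set q : ℝ → E := fun σ => (Module.End.eigenspace (A : E →ₗ[ℝ] E) σ).starProjection g with hqdef
  have hq : ∀ σ, S (S.adjoint (q σ)) = σ • q σ := fun σ =>
    Module.End.mem_eigenspace_iff.1
      ((Module.End.eigenspace (A : E →ₗ[ℝ] E) σ).starProjection_apply_mem g)
  have hTq : ∀ σ, T (S.adjoint (q σ)) = σ • S.adjoint (q σ) := fun σ => by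
    change S.adjoint (S (S.adjoint (q σ))) = _
    rw [hq, map_smul]
  have hmem : ∀ (c : ℝ → ℝ) σ,
      c σ • S.adjoint (q σ) ∈ Module.End.eigenspace (T : H →ₗ[ℝ] H) σ := fun c σ =>
    Submodule.smul_mem _ _ (Module.End.mem_eigenspace_iff.2 (hTq σ))
  have hbessel := sum_norm_sq_starProjection_eigenspace_le hA g
  have hsq : Summable fun σ => ‖q σ‖ ^ 2 :=
    summable_of_sum_le (fun _ => sq_nonneg _) hbessel
  have hterm : ∀ (c : ℝ → ℝ) (C : ℝ), (∀ σ, 0 ≤ σ → σ ≤ κ → c σ ^ 2 * σ ≤ C ^ 2) → ∀ σ,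
      ‖c σ • S.adjoint (q σ)‖ ^ 2 ≤ C ^ 2 * ‖q σ‖ ^ 2 := fun c C hc σ => by
    rw [norm_smul, mul_pow, norm_sq_adjoint_of_eigenvector (hq σ), Real.norm_eq_abs, sq_abs]
    rcases eq_or_ne (q σ) 0 with h0 | h0
    · simp [h0]
    · obtain ⟨h1, h2⟩ := eigenvalue_mem_Icc hS (hq σ) h0
      rw [← mul_assoc]
      exact mul_le_mul_of_nonneg_right (hc σ h1 h2) (sq_nonneg _)
  have hnorm : ∀ (c : ℝ → ℝ) (C : ℝ), 0 ≤ C → (∀ σ, 0 ≤ σ → σ ≤ κ → c σ ^ 2 * σ ≤ C ^ 2) →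
      ∀ w, HasSum (fun σ => c σ • S.adjoint (q σ)) w → ‖w‖ ≤ C * ‖g‖ := fun c C hC hc w hw => by
    refine le_of_tendsto hw.norm (.of_forall fun s => ?_)
    refine le_of_sq_le_sq ?_ (by positivity)
    rw [mul_pow]
    refine le_trans (le_of_eq (hT.orthogonalFamily_eigenspaces.norm_sum
      (fun σ => ⟨c σ • S.adjoint (q σ), hmem c σ⟩) s)) ?_
    refine (Finset.sum_le_sum fun σ _ => hterm c C hc σ).trans ?_
    rw [← Finset.mul_sum]
    exact mul_le_mul_of_nonneg_left (hbessel s) (sq_nonneg _)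
  have hpow : ∀ σ : ℝ, 0 < σ → (σ ^ (r - 1)) ^ 2 * σ = (σ ^ (r - 1 / 2)) ^ 2 := fun σ hσ => by
    rw [← Real.rpow_natCast, ← Real.rpow_natCast, ← Real.rpow_mul hσ.le, ← Real.rpow_mul hσ.le]
    nth_rewrite 2 [← Real.rpow_one σ]
    rw [← Real.rpow_add hσ]
    congr 1
    push_cast
    ring
  have hsum : Summable fun σ => σ ^ (r - 1) • S.adjoint (q σ) := by
    refine (hT.orthogonalFamily_eigenspaces.summable_iff_norm_sq_summable
      (fun σ => ⟨σ ^ (r - 1) • S.adjoint (q σ), hmem (fun σ => σ ^ (r - 1)) σ⟩)).2 ?_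
    refine Summable.of_nonneg_of_le (fun _ => sq_nonneg _)
      (hterm (fun σ => σ ^ (r - 1)) (κ ^ (r - 1 / 2)) fun σ h0 h1 => ?_)
      (hsq.mul_left _)
    rcases h0.eq_or_lt with rfl | h0
    · rw [mul_zero]; positivity
    · rw [hpow σ h0]
      have := Real.rpow_le_rpow h0.le h1 (by linarith : 0 ≤ r - 1 / 2)
      gcongr
  obtain ⟨w₀, hw₀⟩ := hsum
  refine ⟨w₀, ?_, fun v hv => ?_, fun η hη hηκ k hk => ?_⟩
  · have hS₀ : ∀ σ, S (σ ^ (r - 1) • S.adjoint (q σ)) = σ ^ r • q σ := fun σ => by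
      rw [map_smul, hq, smul_smul]
      rcases eq_or_ne (q σ) 0 with h0 | h0
      · rw [h0, smul_zero, smul_zero]
      · obtain ⟨h1, -⟩ := eigenvalue_mem_Icc hS (hq σ) h0
        rcases h1.eq_or_lt with rfl | h1
        · rw [mul_zero, Real.zero_rpow (by linarith)]
        · congr 1
          nth_rewrite 2 [← Real.rpow_one σ]
          rw [← Real.rpow_add h1]
          congr 1
          ring
    refine (hw₀.mapL S).unique ?_
    simp_rw [hS₀]
    exact h
  · have h1 := hw₀.mapL (innerSL ℝ v)
    have h2 : ∀ σ, innerSL ℝ v (σ ^ (r - 1) • S.adjoint (q σ)) = 0 := fun σ => by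
      rw [map_smul, innerSL_apply_apply, adjoint_inner_right, hv, inner_zero_left, smul_zero]
    simp_rw [h2] at h1
    rw [real_inner_comm]
    exact h1.unique hasSum_zero
  · set B : H →L[ℝ] H := .id ℝ H - η • T
    have hB : ∀ σ (j : ℕ), (B ^ j) (S.adjoint (q σ)) = (1 - η * σ) ^ j • S.adjoint (q σ) := by
      intro σ j
      induction j with
      | zero => simp
      | succ j ih =>
        rw [pow_succ]
        change (B ^ j) (B (S.adjoint (q σ))) = _
        rw [show B (S.adjoint (q σ)) = (1 - η * σ) • S.adjoint (q σ) by
          simp [B, hTq, smul_smul, sub_smul], map_smul, ih, smul_smul, pow_succ']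
    refine hnorm (fun σ => (1 - η * σ) ^ k * σ ^ (r - 1)) _
      (Real.rpow_nonneg (div_nonneg (by linarith) (by positivity)) _) (fun σ h0 h1 => ?_) _ ?_
    · rcases h0.eq_or_lt with rfl | h0
      · rw [mul_zero]; positivity
      · have hησ : η * σ ≤ 1 := (mul_le_mul_of_nonneg_left h1 hη.le).trans hηκ
        rw [mul_pow, mul_assoc, hpow σ h0, ← mul_pow]
        exact pow_le_pow_left₀ (mul_nonneg (pow_nonneg (sub_nonneg.2 hησ) _)
          (Real.rpow_nonneg h0.le _))
          (one_sub_pow_mul_rpow_le hη h0.le hησ (by linarith) hk) 2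
    · convert hw₀.mapL (B ^ k) using 2 with σ
      rw [map_smul, hB, smul_smul, mul_comm]

end Operator

/-! ### The population risk and its gradient descent -/

section Population

theorem BoundedData.ae_bound {H : Type*} [NormedAddCommGroup H] [MeasurableSpace H]
    {ρ : Measure (H × ℝ)} {M κ : ℝ} (h : BoundedData ρ M κ) :
    ∀ᵐ z ∂ρ, |z.2| ≤ M ∧ ‖z.1‖ ^ 2 ≤ κ := by
  filter_upwards [h.abs_le, ae_of_ae_map measurable_fst.aemeasurable h.norm_sq_le] with z h1 h2
  exact ⟨h1, h2⟩

variable {H : Type*} [NormedAddCommGroup H] [InnerProductSpace ℝ H]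

/-- Half the gradient at `u` of the squared loss on the data point `z`. -/
noncomputable def lossGrad (z : H × ℝ) (u : H) : H :=
  (⟪u, z.1⟫ - z.2) • z.1

/-- One incremental gradient step of size `η` on the data point `z`. -/
noncomputable def gradStep (η : ℝ) (z : H × ℝ) (u : H) : H :=
  u - η • lossGrad z u

theorem norm_sq_gradStep_le {z : H × ℝ} {M κ η : ℝ} (hy : |z.2| ≤ M) (hx : ‖z.1‖ ^ 2 ≤ κ)
    (hη : 0 ≤ η) (hηκ : η * κ ≤ 1) (u : H) :
    ‖gradStep η z u‖ ^ 2 ≤ ‖u‖ ^ 2 + η * M ^ 2 := by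
  have h1 : η * ‖z.1‖ ^ 2 ≤ 1 := (mul_le_mul_of_nonneg_left hx hη).trans hηκ
  have h2 : z.2 ^ 2 ≤ M ^ 2 := sq_le_sq' (abs_le.1 hy).1 (abs_le.1 hy).2
  rw [gradStep, lossGrad, norm_sub_sq_real, smul_smul, inner_smul_right, norm_smul, mul_pow,
    Real.norm_eq_abs, sq_abs]
  set a := ⟪u, z.1⟫
  -- the increment is at most `η ((a - y)² - 2 (a - y) a) = η (y² - a²)`
  nlinarith [mul_le_mul_of_nonneg_left h1 (mul_nonneg hη (sq_nonneg (a - z.2))),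
    mul_le_mul_of_nonneg_left h2 hη, mul_nonneg hη (sq_nonneg a)]

theorem norm_lossGrad_le {z : H × ℝ} {M κ : ℝ} (hy : |z.2| ≤ M) (hx : ‖z.1‖ ^ 2 ≤ κ) (u : H) :
    ‖lossGrad z u‖ ≤ (√κ * ‖u‖ + M) * √κ := by
  have h1 : ‖z.1‖ ≤ √κ := Real.le_sqrt_of_sq_le hx
  rw [lossGrad, norm_smul, Real.norm_eq_abs]
  have h2 : |⟪u, z.1⟫ - z.2| ≤ √κ * ‖u‖ + M := (abs_sub _ _).trans
    (add_le_add ((abs_real_inner_le_norm _ _).trans (by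
      rw [mul_comm]; gcongr)) hy)
  gcongr
  exact (abs_nonneg _).trans h2

variable [MeasurableSpace H]

/-- Half the gradient of the risk at `u`. -/
noncomputable def riskGrad (ρ : Measure (H × ℝ)) (u : H) : H :=
  ∫ z, lossGrad z u ∂ρ

/-- Gradient descent on the risk with step size `η`, started at `0`. -/
noncomputable def riskDescent (ρ : Measure (H × ℝ)) (η : ℝ) : ℕ → H
  | 0 => 0
  | k + 1 => riskDescent ρ η k - η • riskGrad ρ (riskDescent ρ η k)

variable {ρ : Measure (H × ℝ)} {M κ : ℝ}

variable [BorelSpace H] [SecondCountableTopology H]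

theorem measurable_lossGrad : Measurable fun p : (H × ℝ) × H => lossGrad p.1 p.2 := by
  unfold lossGrad
  fun_prop

variable [IsProbabilityMeasure ρ]

theorem BoundedData.integrable_lossGrad (h : BoundedData ρ M κ) (u : H) :
    Integrable (fun z => lossGrad z u) ρ := by
  refine .of_bound (measurable_lossGrad.comp
    (measurable_id.prodMk measurable_const)).aestronglyMeasurable ((√κ * ‖u‖ + M) * √κ) ?_
  filter_upwards [h.ae_bound] with z hz using norm_lossGrad_le hz.1 hz.2 u

theorem BoundedData.integrable_residual_sq (h : BoundedData ρ M κ) (u : H) :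
    Integrable (fun z : H × ℝ => (⟪u, z.1⟫ - z.2) ^ 2) ρ := by
  refine .of_bound (by fun_prop) ((‖u‖ * √κ + M) ^ 2) ?_
  filter_upwards [h.ae_bound] with z hz
  rw [norm_pow, Real.norm_eq_abs]
  refine pow_le_pow_left₀ (abs_nonneg _) ((abs_sub _ _).trans (add_le_add ?_ hz.1)) 2
  exact (abs_real_inner_le_norm _ _).trans (by gcongr; exact Real.le_sqrt_of_sq_le hz.2)

theorem BoundedData.integrable_inner_mul_inner (h : BoundedData ρ M κ) (u v : H) :
    Integrable (fun z : H × ℝ => ⟪u, z.1⟫ * ⟪v, z.1⟫) ρ := by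
  refine .of_bound (by fun_prop) ((‖u‖ * √κ) * (‖v‖ * √κ)) ?_
  filter_upwards [h.ae_bound] with z hz
  have hx := Real.le_sqrt_of_sq_le hz.2
  rw [norm_mul, Real.norm_eq_abs, Real.norm_eq_abs]
  gcongr
  · exact (abs_real_inner_le_norm _ _).trans (by gcongr)
  · exact (abs_real_inner_le_norm _ _).trans (by gcongr)

theorem BoundedData.integrable_snd_mul_inner (h : BoundedData ρ M κ) (v : H) :
    Integrable (fun z : H × ℝ => z.2 * ⟪v, z.1⟫) ρ := by
  refine .of_bound (by fun_prop) (M * (‖v‖ * √κ)) ?_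
  filter_upwards [h.ae_bound] with z hz
  have hx := Real.le_sqrt_of_sq_le hz.2
  rw [norm_mul, Real.norm_eq_abs, Real.norm_eq_abs]
  gcongr
  · exact h.M_pos.le
  · exact hz.1
  · exact (abs_real_inner_le_norm _ _).trans (by gcongr)

theorem BoundedData.inner_inclusion (h : BoundedData ρ M κ) (u v : H) :
    ⟪inclusion h u, inclusion h v⟫ = ∫ z, ⟪u, z.1⟫ * ⟪v, z.1⟫ ∂ρ := by
  have h1 : ⟪inclusion h u, inclusion h v⟫ = ∫ x, ⟪u, x⟫ * ⟪v, x⟫ ∂ρ.fst := by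
    rw [L2.inner_def]
    refine integral_congr_ae ?_
    filter_upwards [(h.memLp_inner u).coeFn_toLp, (h.memLp_inner v).coeFn_toLp] with x hu hv
    change (h.memLp_inner v).toLp _ x * (h.memLp_inner u).toLp _ x = _
    rw [hu, hv, mul_comm]
  rw [h1, Measure.fst, integral_map measurable_fst.aemeasurable (by fun_prop)]

theorem BoundedData.inner_regressionLp_inclusion (h : BoundedData ρ M κ) (v : H) :
    ⟪regressionLp h, inclusion h v⟫ = ∫ z, z.2 * ⟪v, z.1⟫ ∂ρ := by
  have h1 : ⟪regressionLp h, inclusion h v⟫ = ∫ x, regressionFun ρ x * ⟪v, x⟫ ∂ρ.fst := by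
    rw [L2.inner_def]
    refine integral_congr_ae ?_
    filter_upwards [h.memLp_regressionFun.coeFn_toLp, (h.memLp_inner v).coeFn_toLp] with x hu hv
    change (h.memLp_inner v).toLp _ x * h.memLp_regressionFun.toLp _ x = _
    rw [hu, hv, mul_comm]
  have h2 := h.integrable_snd_mul_inner v
  rw [h1]
  rw [← ρ.disintegrate ρ.condKernel] at h2
  have h3 := Measure.integral_compProd h2
  rw [ρ.disintegrate ρ.condKernel] at h3
  rw [h3]
  exact integral_congr_ae (.of_forall fun x => (integral_mul_const _ _).symm)

theorem BoundedData.norm_inclusion_sq_le (h : BoundedData ρ M κ) : ‖inclusion h‖ ^ 2 ≤ κ := by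
  have h1 : ‖inclusion h‖ ≤ √κ :=
    ContinuousLinearMap.opNorm_le_bound _ (Real.sqrt_nonneg _) h.norm_toLp_inner_le
  calc _ ≤ √κ ^ 2 := pow_le_pow_left₀ (norm_nonneg _) h1 2
    _ = κ := Real.sq_sqrt h.κ_pos.le

theorem BoundedData.norm_inclusion_apply_sq_le (h : BoundedData ρ M κ) (v : H) :
    ‖inclusion h v‖ ^ 2 ≤ κ * ‖v‖ ^ 2 := by
  calc _ ≤ (‖inclusion h‖ * ‖v‖) ^ 2 :=
        pow_le_pow_left₀ (norm_nonneg _) ((inclusion h).le_opNorm v) 2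
    _ ≤ _ := by rw [mul_pow]; gcongr; exact h.norm_inclusion_sq_le

variable [CompleteSpace H]

theorem BoundedData.inner_riskGrad (h : BoundedData ρ M κ) (u v : H) :
    ⟪riskGrad ρ u, v⟫ = ⟪inclusion h u - regressionLp h, inclusion h v⟫ := by
  rw [inner_sub_left, h.inner_inclusion, h.inner_regressionLp_inclusion,
    ← integral_sub (h.integrable_inner_mul_inner u v) (h.integrable_snd_mul_inner v),
    real_inner_comm, riskGrad, ← integral_inner (h.integrable_lossGrad u)]
  refine integral_congr_ae (.of_forall fun z => ?_)
  simp only [lossGrad, inner_smul_right]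
  ring

theorem BoundedData.riskGrad_sub (h : BoundedData ρ M κ) (u w : H) :
    riskGrad ρ u - riskGrad ρ w = (inclusion h).adjoint (inclusion h (u - w)) := by
  refine ext_inner_right ℝ fun v => ?_
  rw [inner_sub_left, h.inner_riskGrad, h.inner_riskGrad, ← inner_sub_left,
    ContinuousLinearMap.adjoint_inner_left, map_sub]
  congr 1
  abel

theorem BoundedData.risk_add (h : BoundedData ρ M κ) (u v : H) :
    risk ρ (u + v) = risk ρ u + 2 * ⟪riskGrad ρ u, v⟫ + ‖inclusion h v‖ ^ 2 := by
  have h1 : Integrable (fun z => 2 * ⟪v, lossGrad z u⟫) ρ :=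
    ((h.integrable_lossGrad u).const_inner v).const_mul 2
  have h2 : Integrable (fun z => (⟪u, z.1⟫ - z.2) ^ 2 + 2 * ⟪v, lossGrad z u⟫) ρ :=
    (h.integrable_residual_sq u).add h1
  rw [← real_inner_self_eq_norm_sq, h.inner_inclusion, real_inner_comm, riskGrad,
    ← integral_inner (h.integrable_lossGrad u), ← integral_const_mul, risk, risk,
    ← integral_add (h.integrable_residual_sq u) h1,
    ← integral_add h2 (h.integrable_inner_mul_inner v v)]
  refine integral_congr_ae (.of_forall fun z => ?_)
  simp only [lossGrad, inner_smul_right, inner_add_left]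
  ring

theorem BoundedData.risk_riskDescent_le (h : BoundedData ρ M κ) {η : ℝ} (hη : 0 ≤ η)
    (hηκ : η * κ ≤ 1) (k : ℕ) : risk ρ (riskDescent ρ η k) ≤ M ^ 2 := by
  induction k with
  | zero =>
    have : ∀ᵐ z ∂ρ, (⟪(0 : H), z.1⟫ - z.2) ^ 2 ≤ M ^ 2 := by
      filter_upwards [h.abs_le] with z hz
      simpa using sq_le_sq' (_root_.abs_le.1 hz).1 (_root_.abs_le.1 hz).2
    calc risk ρ (0 : H) ≤ ∫ _, M ^ 2 ∂ρ :=
          integral_mono_ae (h.integrable_residual_sq 0) (integrable_const _) this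
      _ = M ^ 2 := by simp
  | succ k ih =>
    rw [riskDescent]
    set u := riskDescent ρ η k
    rw [sub_eq_add_neg, h.risk_add, inner_neg_right, inner_smul_right, real_inner_self_eq_norm_sq,
      map_neg, norm_neg, map_smul, norm_smul, mul_pow, Real.norm_eq_abs, sq_abs]
    have h1 := h.norm_inclusion_apply_sq_le (riskGrad ρ u)
    have h2 : η ^ 2 * ‖inclusion h (riskGrad ρ u)‖ ^ 2 ≤ η * ‖riskGrad ρ u‖ ^ 2 :=
      calc _ ≤ η ^ 2 * (κ * ‖riskGrad ρ u‖ ^ 2) := by gcongr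
        _ = η * ((η * κ) * ‖riskGrad ρ u‖ ^ 2) := by ring
        _ ≤ η * (1 * ‖riskGrad ρ u‖ ^ 2) := by gcongr
        _ = _ := by ring
    nlinarith [mul_nonneg hη (sq_nonneg ‖riskGrad ρ u‖)]

theorem BoundedData.norm_sq_riskDescent_le (h : BoundedData ρ M κ) {η : ℝ} (hη : 0 ≤ η)
    (hηκ : η * κ ≤ 1) (k : ℕ) : ‖riskDescent ρ η k‖ ^ 2 ≤ k * (η * M ^ 2) := by
  induction k with
  | zero => simp [riskDescent]
  | succ k ih =>
    rw [riskDescent]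
    set u := riskDescent ρ η k
    have h1 : u - η • riskGrad ρ u = ∫ z, gradStep η z u ∂ρ := by
      have h3 : Integrable (fun z => η • lossGrad z u) ρ := (h.integrable_lossGrad u).smul η
      simp only [gradStep, riskGrad]
      rw [integral_sub (integrable_const _) h3, integral_smul]
      simp
    have h2 : ‖∫ z, gradStep η z u ∂ρ‖ ≤ √(‖u‖ ^ 2 + η * M ^ 2) := by
      refine (norm_integral_le_of_norm_le_const (C := √(‖u‖ ^ 2 + η * M ^ 2)) ?_).trans
        (le_of_eq ?_)
      · filter_upwards [h.ae_bound] with z hz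
        exact Real.le_sqrt_of_sq_le (norm_sq_gradStep_le hz.1 hz.2 hη hηκ u)
      · simp
    rw [h1]
    calc _ ≤ √(‖u‖ ^ 2 + η * M ^ 2) ^ 2 := pow_le_pow_left₀ (norm_nonneg _) h2 2
      _ = ‖u‖ ^ 2 + η * M ^ 2 := Real.sq_sqrt (by positivity)
      _ ≤ _ := by push_cast; linarith

theorem integralOp_eq_comp_adjoint (h : BoundedData ρ M κ) :
    integralOp h = (inclusion h).comp (inclusion h).adjoint :=
  ContinuousLinearMap.ext fun f => toLp_integralOp h f

/-- A point whose image in `L²` is nearest to the regression function is critical for the risk. -/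
theorem BoundedData.riskGrad_eq_zero (h : BoundedData ρ M κ) {w : H}
    (hw : ∀ v, ‖regressionLp h - inclusion h w‖ ≤ ‖regressionLp h - inclusion h v‖) :
    riskGrad ρ w = 0 := by
  have key : ∀ t : ℝ, 0 ≤ (-2 * ⟪riskGrad ρ w, riskGrad ρ w⟫) * t
      + ‖inclusion h (riskGrad ρ w)‖ ^ 2 * t ^ 2 := fun t => by
    have h1 := pow_le_pow_left₀ (norm_nonneg _) (hw (w - t • riskGrad ρ w)) 2
    have h2 : regressionLp h - inclusion h (w - t • riskGrad ρ w)
        = (regressionLp h - inclusion h w) + t • inclusion h (riskGrad ρ w) := by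
      rw [map_sub, map_smul]; abel
    rw [h2, norm_add_sq_real, inner_smul_right, norm_smul, mul_pow, Real.norm_eq_abs, sq_abs,
      ← neg_sub (inclusion h w), inner_neg_left, ← h.inner_riskGrad] at h1
    nlinarith
  set a := ⟪riskGrad ρ w, riskGrad ρ w⟫ with ha
  have ha0 : 0 ≤ a := real_inner_self_nonneg
  set b := ‖inclusion h (riskGrad ρ w)‖ ^ 2
  have hb : 0 ≤ b := sq_nonneg _
  rw [← inner_self_eq_zero (𝕜 := ℝ), ← ha]
  have h1 := key (a / (b + 1))
  have h2 : (-2 * a) * (a / (b + 1)) + b * (a / (b + 1)) ^ 2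
      = -(a ^ 2 * (b + 2)) / (b + 1) ^ 2 := by
    field_simp
    ring
  rw [h2, neg_div, Left.nonneg_neg_iff] at h1
  by_contra h3
  have h4 : 0 < a := lt_of_le_of_ne ha0 (Ne.symm h3)
  have : 0 < a ^ 2 * (b + 2) / (b + 1) ^ 2 := by positivity
  linarith

/-- Under the source condition there is exactly one minimizer of the risk of minimal norm, and
gradient descent on the risk approaches it at a polynomial rate. -/
theorem SourceCondition.exists_minNormMinimizer {h : BoundedData ρ M κ} {r : ℝ} (hr : 1 / 2 < r)
    {g : Lp ℝ 2 ρ.fst} (hg : SourceCondition h r g) :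
    ∃ w₀ : H, (∀ w, IsMinNormMinimizer ρ w ↔ w = w₀) ∧
      ∀ η : ℝ, 0 < η → η * κ ≤ 1 → ∀ k : ℕ, 0 < k →
        ‖riskDescent ρ η k - w₀‖ ≤ ((r - 1 / 2) / (η * k)) ^ (r - 1 / 2) * ‖g‖ := by
  obtain ⟨gρ, -, hmin, hpow⟩ := hg
  rw [integralOp_eq_comp_adjoint] at hpow
  obtain ⟨w₀, hw₀, hker, hrate⟩ :=
    exists_preimage_of_isFractionalPower h.κ_pos h.norm_inclusion_sq_le hr hpow
  have hcrit : riskGrad ρ w₀ = 0 := h.riskGrad_eq_zero fun v => by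
    rw [hw₀]
    exact hmin _ (subset_closure ⟨v, (h.memLp_inner v).coeFn_toLp⟩)
  have hrisk : ∀ w, risk ρ w = risk ρ w₀ + ‖inclusion h (w - w₀)‖ ^ 2 := fun w => by
    have := h.risk_add w₀ (w - w₀)
    rwa [hcrit, inner_zero_left, mul_zero, add_zero, add_sub_cancel] at this
  have hw₀min : w₀ ∈ riskMinimizers ρ := fun v => by
    rw [hrisk v]; linarith [sq_nonneg ‖inclusion h (v - w₀)‖]
  have hpyth : ∀ w ∈ riskMinimizers ρ, ‖w‖ ^ 2 = ‖w₀‖ ^ 2 + ‖w - w₀‖ ^ 2 := fun w hw => by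
    have h1 := hw w₀
    rw [hrisk w] at h1
    have h2 : inclusion h (w - w₀) = 0 := by
      rw [← norm_eq_zero, ← sq_eq_zero_iff]
      exact le_antisymm (by linarith) (sq_nonneg _)
    have h3 := norm_add_sq_real w₀ (w - w₀)
    rwa [hker _ h2, mul_zero, add_zero, add_sub_cancel] at h3
  refine ⟨w₀, fun w => ⟨fun hw => ?_, ?_⟩, fun η hη hηκ k hk => ?_⟩
  · have h1 := hpyth w hw.1
    have h2 := pow_le_pow_left₀ (norm_nonneg _) (hw.2 w₀ hw₀min) 2
    rw [← sub_eq_zero, ← norm_eq_zero, ← sq_eq_zero_iff]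
    exact le_antisymm (by linarith) (sq_nonneg _)
  · rintro rfl
    refine ⟨hw₀min, fun v hv => le_of_sq_le_sq ?_ (norm_nonneg _)⟩
    rw [hpyth v hv]
    linarith [sq_nonneg ‖v - w‖]
  · set B : H →L[ℝ] H := .id ℝ H - η • (inclusion h).adjoint.comp (inclusion h) with hB
    have herr : ∀ j, riskDescent ρ η j - w₀ = -(B ^ j) w₀ := fun j => by
      induction j with
      | zero => simp [riskDescent]
      | succ j ih =>
        have hT := h.riskGrad_sub (riskDescent ρ η j) w₀
        rw [hcrit, sub_zero] at hT
        rw [riskDescent, hT, pow_succ']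
        change _ = -B ((B ^ j) w₀)
        rw [← map_neg, ← ih, hB]
        simp only [sub_apply, smul_apply,
          ContinuousLinearMap.comp_apply, ContinuousLinearMap.id_apply]
        abel
    rw [herr, norm_neg]
    exact hrate η hη hηκ k hk

end Population

/-! ### Incremental passes over bounded data -/

section Truncation

variable {H : Type*} [NormedAddCommGroup H]

/-- The data point `z`, replaced by `0` if it violates the bounds `|y| ≤ M`, `‖x‖² ≤ κ`. -/
noncomputable def truncate (M κ : ℝ) (z : H × ℝ) : H × ℝ :=
  open Classical in if |z.2| ≤ M ∧ ‖z.1‖ ^ 2 ≤ κ then z else 0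

theorem truncate_of_le {M κ : ℝ} {z : H × ℝ} (hz : |z.2| ≤ M ∧ ‖z.1‖ ^ 2 ≤ κ) :
    truncate M κ z = z := if_pos hz

theorem truncate_bound {M κ : ℝ} (hM : 0 ≤ M) (hκ : 0 ≤ κ) (z : H × ℝ) :
    |(truncate M κ z).2| ≤ M ∧ ‖(truncate M κ z).1‖ ^ 2 ≤ κ := by
  unfold truncate
  split_ifs with h
  · exact h
  · simpa using ⟨hM, hκ⟩

variable [MeasurableSpace H] [BorelSpace H]

theorem measurable_truncate (M κ : ℝ) : Measurable (truncate M κ : H × ℝ → H × ℝ) := by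
  classical
  unfold truncate
  refine Measurable.ite ?_ measurable_id measurable_const
  exact (measurableSet_le measurable_snd.abs measurable_const).inter
    (measurableSet_le (measurable_fst.norm.pow_const 2) measurable_const)

end Truncation

section Pass

variable {H : Type*} [NormedAddCommGroup H] [InnerProductSpace ℝ H]

/-- The linear part `v ↦ v - η ⟪v, x⟫ x` of an incremental gradient step. -/
noncomputable def stepLinear (η : ℝ) (x : H) : H →L[ℝ] H :=
  .id ℝ H - η • (innerSL ℝ x).smulRight x

theorem stepLinear_apply (η : ℝ) (x v : H) : stepLinear η x v = v - η • (⟪v, x⟫ • x) := by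
  simp [stepLinear, real_inner_comm]

theorem norm_stepLinear_le {η κ : ℝ} {x : H} (hη : 0 ≤ η) (hηκ : η * κ ≤ 1) (hx : ‖x‖ ^ 2 ≤ κ) :
    ‖stepLinear η x‖ ≤ 1 := by
  refine ContinuousLinearMap.opNorm_le_bound _ zero_le_one fun v => ?_
  rw [one_mul]
  refine le_of_sq_le_sq ?_ (norm_nonneg _)
  have h1 : η * ‖x‖ ^ 2 ≤ 1 := (mul_le_mul_of_nonneg_left hx hη).trans hηκ
  rw [stepLinear_apply, norm_sub_sq_real, smul_smul, inner_smul_right, norm_smul, mul_pow,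
    Real.norm_eq_abs, sq_abs]
  nlinarith [mul_le_mul_of_nonneg_left h1 (mul_nonneg hη (sq_nonneg ⟪v, x⟫)),
    mul_nonneg hη (sq_nonneg ⟪v, x⟫)]

theorem gradStep_sub_gradStep (η : ℝ) (z : H × ℝ) (u v : H) :
    gradStep η z u - gradStep η z v = stepLinear η z.1 (u - v) := by
  rw [stepLinear_apply, gradStep, gradStep, lossGrad, lossGrad, inner_sub_left, sub_smul, sub_smul,
    sub_smul]
  simp only [smul_sub]
  abel

/-- One pass of incremental gradient steps of size `η` over the data `z`, started at `u`. -/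
noncomputable def gradPass (η : ℝ) {n : ℕ} (z : Fin n → H × ℝ) (u : H) : H :=
  Fin.foldl n (fun v i => gradStep η (z i) v) u

theorem gradPass_succ_last (η : ℝ) {n : ℕ} (z : Fin (n + 1) → H × ℝ) (u : H) :
    gradPass η z u = gradStep η (z (Fin.last n)) (gradPass η (fun i => z i.castSucc) u) := by
  simp [gradPass, Fin.foldl_succ_last]

theorem epoch_eq_gradPass (γ : ℝ) {n : ℕ} (z : Fin n → H × ℝ) (u : H) :
    epoch γ z u = gradPass (γ / n) z u := rfl

theorem norm_gradPass_sub_gradPass_le {η κ : ℝ} (hη : 0 ≤ η) (hηκ : η * κ ≤ 1) {n : ℕ}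
    {z : Fin n → H × ℝ} (hz : ∀ i, ‖(z i).1‖ ^ 2 ≤ κ) (u v : H) :
    ‖gradPass η z u - gradPass η z v‖ ≤ ‖u - v‖ := by
  induction n with
  | zero => simp [gradPass]
  | succ n ih =>
    rw [gradPass_succ_last, gradPass_succ_last, gradStep_sub_gradStep]
    refine ((stepLinear η _).le_of_opNorm_le (norm_stepLinear_le hη hηκ (hz _)) _).trans ?_
    rw [one_mul]
    exact ih fun i => hz _

theorem norm_sq_gradPass_le {η κ M : ℝ} (hη : 0 ≤ η) (hηκ : η * κ ≤ 1) {n : ℕ}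
    {z : Fin n → H × ℝ} (hz : ∀ i, |(z i).2| ≤ M ∧ ‖(z i).1‖ ^ 2 ≤ κ) (u : H) :
    ‖gradPass η z u‖ ^ 2 ≤ ‖u‖ ^ 2 + n * (η * M ^ 2) := by
  induction n with
  | zero => simp [gradPass]
  | succ n ih =>
    rw [gradPass_succ_last]
    refine (norm_sq_gradStep_le (hz _).1 (hz _).2 hη hηκ _).trans ?_
    have := ih (z := fun i => z i.castSucc) fun i => hz _
    push_cast
    linarith

theorem norm_sq_iterate_le {γ κ M : ℝ} {n : ℕ} (hγ : 0 ≤ γ) (hγκ : γ / n * κ ≤ 1) (hn : 0 < n)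
    {z : Fin n → H × ℝ} (hz : ∀ i, |(z i).2| ≤ M ∧ ‖(z i).1‖ ^ 2 ≤ κ) (t : ℕ) :
    ‖iterate γ z 0 t‖ ^ 2 ≤ γ * t * M ^ 2 := by
  induction t with
  | zero => simp [iterate]
  | succ t ih =>
    rw [iterate, epoch_eq_gradPass]
    refine (norm_sq_gradPass_le (by positivity) hγκ hz _).trans ?_
    have hn' : (n : ℝ) ≠ 0 := by positivity
    have : (n : ℝ) * (γ / n * M ^ 2) = γ * M ^ 2 := by field_simp
    rw [this]
    push_cast
    linarith

variable [MeasurableSpace H]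

/-- The distance of the iterates to gradient descent on the risk is at most the sum of the errors
that single passes started on the descent trajectory commit, because passes are nonexpansive. -/
theorem norm_iterate_sub_riskDescent_le (ρ : Measure (H × ℝ)) {γ κ : ℝ} {n : ℕ} (hγ : 0 ≤ γ)
    (hγκ : γ / n * κ ≤ 1) {z : Fin n → H × ℝ} (hz : ∀ i, ‖(z i).1‖ ^ 2 ≤ κ) (t : ℕ) :
    ‖iterate γ z 0 t - riskDescent ρ (γ / n) (n * t)‖ ≤
      ∑ s ∈ Finset.range t, ‖gradPass (γ / n) z (riskDescent ρ (γ / n) (n * s))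
        - riskDescent ρ (γ / n) (n * s + n)‖ := by
  induction t with
  | zero => simp [iterate, riskDescent]
  | succ t ih =>
    rw [iterate, epoch_eq_gradPass, Finset.sum_range_succ, mul_add_one]
    refine (norm_sub_le_norm_sub_add_norm_sub _
      (gradPass (γ / n) z (riskDescent ρ (γ / n) (n * t))) _).trans ?_
    gcongr
    exact (norm_gradPass_sub_gradPass_le (by positivity) hγκ hz _ _).trans ih

/-- The noise `-η (∇ℓ - ∇ℰ) / 2` of the gradient at the `j`-th point of gradient descent on the
risk, evaluated at a truncated data point. -/
noncomputable def gradNoise (ρ : Measure (H × ℝ)) (M κ η : ℝ) (j : ℕ) (z : H × ℝ) : H :=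
  -(η • (lossGrad (truncate M κ z) (riskDescent ρ η j) - riskGrad ρ (riskDescent ρ η j)))

/-- The error of a single pass obeys an affine recursion driven by independent centred noise. -/
theorem affineFold_gradNoise (ρ : Measure (H × ℝ)) (M κ η c : ℝ) (k : ℕ) {n : ℕ}
    {z : Fin n → H × ℝ} (hz : ∀ i, |(z i).2| ≤ M ∧ ‖(z i).1‖ ^ 2 ≤ κ) :
    affineFold (fun z => stepLinear η (truncate M κ z).1)
        (fun (i : Fin n) z => c • gradNoise ρ M κ η (k + i) z) z 0
      = c • (gradPass η z (riskDescent ρ η k) - riskDescent ρ η (k + n)) := by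
  induction n with
  | zero => simp [affineFold, gradPass]
  | succ n ih =>
    have h := ih (z := fun i => z i.castSucc) fun i => hz _
    rw [affineFold] at h
    rw [affineFold, Fin.foldl_succ_last]
    simp only [Fin.val_castSucc, Fin.val_last]
    rw [h, gradPass_succ_last, ← add_assoc, riskDescent, gradNoise, truncate_of_le (hz _), map_smul,
      ← smul_add, ← gradStep_sub_gradStep]
    congr 1
    simp only [gradStep, smul_sub]
    abel

variable [BorelSpace H] [SecondCountableTopology H]

theorem measurable_gradNoise (ρ : Measure (H × ℝ)) (M κ η : ℝ) (j : ℕ) :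
    Measurable (gradNoise ρ M κ η j) := by
  unfold gradNoise
  refine Measurable.neg (Measurable.const_smul (Measurable.sub_const ?_ _) η)
  exact measurable_lossGrad.comp ((measurable_truncate M κ).prodMk measurable_const)

theorem measurable_stepLinear_truncate (M κ η : ℝ) :
    Measurable fun p : (H × ℝ) × H => stepLinear η (truncate M κ p.1).1 p.2 := by
  simp_rw [stepLinear_apply]
  have h : Measurable fun p : (H × ℝ) × H => (truncate M κ p.1).1 :=
    (measurable_truncate M κ).fst.comp measurable_fst
  exact measurable_snd.sub
    (((measurable_snd.inner h).smul h).const_smul η)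

end Pass

/-! ### Concentration of a pass -/

section Concentration

variable {H : Type*} [NormedAddCommGroup H] [InnerProductSpace ℝ H] [MeasurableSpace H]
  {ρ : Measure (H × ℝ)} {M κ : ℝ}

theorem BoundedData.gradNoise_ae (h : BoundedData ρ M κ) (η : ℝ) (j : ℕ) :
    gradNoise ρ M κ η j =ᵐ[ρ] fun z =>
      -(η • (lossGrad z (riskDescent ρ η j) - riskGrad ρ (riskDescent ρ η j))) := by
  filter_upwards [h.ae_bound] with z hz
  rw [gradNoise, truncate_of_le hz]

variable [IsProbabilityMeasure ρ]

theorem BoundedData.norm_riskGrad_le (h : BoundedData ρ M κ) (u : H) :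
    ‖riskGrad ρ u‖ ≤ (√κ * ‖u‖ + M) * √κ := by
  have := norm_integral_le_of_norm_le_const (μ := ρ) (f := fun z => lossGrad z u)
    (C := (√κ * ‖u‖ + M) * √κ) (by
      filter_upwards [h.ae_bound] with z hz using norm_lossGrad_le hz.1 hz.2 u)
  simpa [riskGrad] using this

theorem BoundedData.norm_gradNoise_le (h : BoundedData ρ M κ) {η : ℝ} (hη : 0 ≤ η) (j : ℕ)
    (z : H × ℝ) :
    ‖gradNoise ρ M κ η j z‖ ≤ η * (2 * ((√κ * ‖riskDescent ρ η j‖ + M) * √κ)) := by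
  have hz := truncate_bound h.M_pos.le h.κ_pos.le z
  rw [gradNoise, norm_neg, norm_smul, Real.norm_of_nonneg hη]
  gcongr
  refine (norm_sub_le _ _).trans ?_
  rw [two_mul]
  exact add_le_add (norm_lossGrad_le hz.1 hz.2 _) (h.norm_riskGrad_le _)

variable [CompleteSpace H] [SecondCountableTopology H] [BorelSpace H]

theorem BoundedData.integral_gradNoise (h : BoundedData ρ M κ) (η : ℝ) (j : ℕ) :
    ∫ z, gradNoise ρ M κ η j z ∂ρ = 0 := by
  rw [integral_congr_ae (h.gradNoise_ae η j), integral_neg, integral_smul,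
    integral_sub (h.integrable_lossGrad _) (integrable_const _)]
  simp [riskGrad]

/-- The variance of the gradient noise is controlled by the risk, which does not increase along
gradient descent, and not by the norm of the descent point. -/
theorem BoundedData.integral_norm_sq_gradNoise_le (h : BoundedData ρ M κ) {η : ℝ} (hη : 0 ≤ η)
    (hηκ : η * κ ≤ 1) (j : ℕ) :
    ∫ z, ‖gradNoise ρ M κ η j z‖ ^ 2 ∂ρ ≤ η ^ 2 * (κ * M ^ 2) := by
  set u := riskDescent ρ η j with hu
  have hi1 := (h.integrable_residual_sq u).const_mul κ
  have hi2 : Integrable (fun z => 2 * ⟪riskGrad ρ u, lossGrad z u⟫) ρ :=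
    ((h.integrable_lossGrad u).const_inner _).const_mul 2
  have hi3 : Integrable (fun z : H × ℝ => κ * (⟪u, z.1⟫ - z.2) ^ 2
      - 2 * ⟪riskGrad ρ u, lossGrad z u⟫) ρ := hi1.sub hi2
  have hi4 : Integrable (fun z : H × ℝ => κ * (⟪u, z.1⟫ - z.2) ^ 2
      - 2 * ⟪riskGrad ρ u, lossGrad z u⟫ + ‖riskGrad ρ u‖ ^ 2) ρ := hi3.add (integrable_const _)
  calc ∫ z, ‖gradNoise ρ M κ η j z‖ ^ 2 ∂ρ
      ≤ ∫ z, η ^ 2 * (κ * (⟪u, z.1⟫ - z.2) ^ 2 - 2 * ⟪riskGrad ρ u, lossGrad z u⟫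
          + ‖riskGrad ρ u‖ ^ 2) ∂ρ := by
        refine integral_mono_of_nonneg (.of_forall fun z => sq_nonneg _) (hi4.const_mul _) ?_
        filter_upwards [h.ae_bound, h.gradNoise_ae η j] with z hz hz'
        simp only [hz', ← hu]
        rw [norm_neg, norm_smul, mul_pow, Real.norm_eq_abs, sq_abs, norm_sub_sq_real,
          real_inner_comm]
        gcongr
        rw [lossGrad, norm_smul, mul_pow, Real.norm_eq_abs, sq_abs, mul_comm]
        gcongr
        exact hz.2
    _ = η ^ 2 * (κ * risk ρ u - ‖riskGrad ρ u‖ ^ 2) := by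
        rw [integral_const_mul, integral_add hi3 (integrable_const _), integral_sub hi1 hi2,
          integral_const_mul, integral_const_mul, integral_inner (h.integrable_lossGrad u),
          ← riskGrad, ← risk, real_inner_self_eq_norm_sq]
        simp only [integral_const, probReal_univ, one_smul]
        ring
    _ ≤ _ := by
        have h1 := h.risk_riskDescent_le hη hηκ j
        have h2 := h.κ_pos.le
        gcongr
        nlinarith [sq_nonneg ‖riskGrad ρ u‖, mul_le_mul_of_nonneg_left h1 h2]

/-- Exponential moment of the error of a single pass, at the scale `γ √κ M / √n` of its standard
deviation. The restriction `16 t ≤ n` keeps the noise, whose size may grow like `√t / √n` on that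
scale, bounded by one. -/
theorem BoundedData.integral_cosh_pass_le (h : BoundedData ρ M κ) {γ : ℝ} (hγ : 0 < γ)
    (hγκ : γ * κ ≤ 1) {n t : ℕ} (ht : 0 < t) (hnt : 16 * t ≤ n) {k : ℕ} (hk : k + n ≤ n * t) :
    (∀ (i : Fin n) (z : H × ℝ),
      ‖(√n / (γ * √κ * M)) • gradNoise ρ M κ (γ / n) (k + i) z‖ ≤ 1) ∧
    ∫ z, Real.cosh ‖affineFold (fun z => stepLinear (γ / n) (truncate M κ z).1)
        (fun (i : Fin n) z => (√n / (γ * √κ * M)) • gradNoise ρ M κ (γ / n) (k + i) z) z 0‖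
      ∂(Measure.pi fun _ : Fin n => ρ) ≤ Real.exp 1 := by
  have hn : 0 < n := by omega
  have hn' : (0 : ℝ) < n := Nat.cast_pos.2 hn
  have hn1 : (1 : ℝ) ≤ n := by exact_mod_cast hn
  have ht1 : (1 : ℝ) ≤ t := by exact_mod_cast ht
  have hκ := h.κ_pos
  have hM := h.M_pos
  have hη : 0 ≤ γ / n := by positivity
  have hηκ : γ / n * κ ≤ 1 := by
    rw [div_mul_eq_mul_div, div_le_one hn']; linarith
  have hsn : √(n : ℝ) ^ 2 = n := Real.sq_sqrt hn'.le
  have hsn0 : 0 < √(n : ℝ) := Real.sqrt_pos.2 hn'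
  have hsκ : √κ ^ 2 = κ := Real.sq_sqrt hκ.le
  have hsκ0 : 0 < √κ := Real.sqrt_pos.2 hκ
  have hst1 : 1 ≤ √(t : ℝ) := Real.one_le_sqrt.2 ht1
  have hst : 4 * √(t : ℝ) ≤ √(n : ℝ) := by
    refine Real.le_sqrt_of_sq_le ?_
    rw [mul_pow, Real.sq_sqrt (by positivity)]
    norm_num
    exact_mod_cast hnt
  have hb : ∀ (i : Fin n) (z : H × ℝ),
      ‖(√n / (γ * √κ * M)) • gradNoise ρ M κ (γ / n) (k + i) z‖ ≤ 1 := fun i z => by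
    have hki : ((k + i : ℕ) : ℝ) ≤ n * t := by
      have := i.2
      exact_mod_cast (show k + i ≤ n * t by omega)
    have h1 : √κ * ‖riskDescent ρ (γ / n) (k + i)‖ ≤ √t * M := by
      refine le_of_sq_le_sq ?_ (by positivity)
      rw [mul_pow, mul_pow, hsκ, Real.sq_sqrt (by positivity)]
      calc _ ≤ κ * (((k + i : ℕ) : ℝ) * (γ / n * M ^ 2)) := by
            gcongr; exact h.norm_sq_riskDescent_le hη hηκ _
        _ ≤ κ * ((n * t) * (γ / n * M ^ 2)) := by gcongr
        _ = (γ * κ) * (t * M ^ 2) := by field_simp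
        _ ≤ 1 * (t * M ^ 2) := by gcongr
        _ = _ := one_mul _
    rw [norm_smul, Real.norm_of_nonneg (by positivity)]
    calc _ ≤ √n / (γ * √κ * M) * (γ / n * (2 * ((√κ * ‖riskDescent ρ (γ / n) (k + i)‖ + M) * √κ)))
            := by gcongr; exact h.norm_gradNoise_le hη _ z
      _ ≤ √n / (γ * √κ * M) * (γ / n * (2 * ((√t * M + √t * M) * √κ))) := by
          gcongr; nlinarith
      _ = √n * (4 * √t) / n := by field_simp; ring
      _ ≤ √n * √n / n := by gcongr
      _ = 1 := by rw [← sq, hsn, div_self hn'.ne']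
  refine ⟨hb, ?_⟩
  refine (integral_cosh_norm_affineFold_le ρ (v := 1 / n)
    (ξ := fun (i : Fin n) z => (√n / (γ * √κ * M)) • gradNoise ρ M κ (γ / n) (k + i) z)
    (fun z => norm_stepLinear_le hη hηκ (truncate_bound hM.le hκ.le z).2)
    (measurable_stepLinear_truncate M κ (γ / n))
    (fun i => (measurable_gradNoise ρ M κ (γ / n) (k + i)).const_smul _) hb
    (fun i => by rw [integral_smul, h.integral_gradNoise, smul_zero]) (fun i => ?_)
    (by positivity)).trans ?_
  · simp_rw [norm_smul, mul_pow]
    rw [integral_const_mul, Real.norm_of_nonneg (by positivity)]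
    calc _ ≤ (√n / (γ * √κ * M)) ^ 2 * ((γ / n) ^ 2 * (κ * M ^ 2)) := by
          gcongr; exact h.integral_norm_sq_gradNoise_le hη hηκ _
      _ = 1 / n := by
          rw [div_pow, mul_pow, mul_pow, hsn, hsκ]
          field_simp
  · calc (1 + 1 / (n : ℝ)) ^ n ≤ Real.exp (1 / n) ^ n := by
          gcongr; linarith [Real.add_one_le_exp (1 / (n : ℝ))]
      _ = Real.exp 1 := by rw [← Real.exp_nat_mul, mul_one_div_cancel hn'.ne']

end Concentration

/-! ### High-probability bounds -/

section HighProbability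

theorem BoundedData.ae_sample_bound {H : Type*} [NormedAddCommGroup H] [MeasurableSpace H]
    {ρ : Measure (H × ℝ)} {M κ : ℝ} {Ω : Type*} [MeasurableSpace Ω] {P : Measure Ω}
    (h : BoundedData ρ M κ) {n : ℕ} {Z : Fin n → Ω → H × ℝ} (hZ : ∀ i, Measurable (Z i))
    (hlaw : ∀ i, P.map (Z i) = ρ) :
    ∀ᵐ ω ∂P, ∀ i, |(Z i ω).2| ≤ M ∧ ‖(Z i ω).1‖ ^ 2 ≤ κ :=
  ae_all_iff.2 fun i => ae_of_ae_map (hZ i).aemeasurable (by rw [hlaw i]; exact h.ae_bound)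

variable {H : Type*} [NormedAddCommGroup H] [InnerProductSpace ℝ H] [CompleteSpace H]
  [SecondCountableTopology H] [MeasurableSpace H] [BorelSpace H] {ρ : Measure (H × ℝ)}
  [IsProbabilityMeasure ρ] {M κ : ℝ} {Ω : Type*} [MeasurableSpace Ω] {P : Measure Ω}
  [IsProbabilityMeasure P]

theorem mul_sqrt_le_rpow_neg_half {γ : ℝ} (hκ : 0 < κ) (hγκ : γ * κ ≤ 1) :
    γ * √κ ≤ κ ^ (-(1 / 2) : ℝ) := by
  rw [Real.rpow_neg hκ.le, ← Real.sqrt_eq_rpow, ← one_div, le_div_iff₀ (Real.sqrt_pos.2 hκ),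
    mul_assoc, Real.mul_self_sqrt hκ.le]
  exact hγκ

/-- By Jensen's inequality, a bound on the mean of `cosh ∘ b` bounds the mean of `b`. -/
theorem sum_lt_of_sum_cosh_lt {t : ℕ} (ht : 0 < t) (b : ℕ → ℝ) {c : ℝ} (hc : 0 < c)
    (h : ∑ s ∈ Finset.range t, Real.cosh (b s) < t * (c / 2)) :
    ∑ s ∈ Finset.range t, b s < t * Real.log c := by
  have ht' : (0 : ℝ) < t := Nat.cast_pos.2 ht
  have h1 := convexOn_exp.map_sum_le (t := Finset.range t) (w := fun _ => 1 / (t : ℝ)) (p := b)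
    (fun _ _ => by positivity) (by simp [ht'.ne']) (fun _ _ => Set.mem_univ _)
  simp only [smul_eq_mul, ← Finset.mul_sum] at h1
  have h2 : ∑ s ∈ Finset.range t, Real.exp (b s) ≤ 2 * ∑ s ∈ Finset.range t, Real.cosh (b s) := by
    rw [Finset.mul_sum]
    refine Finset.sum_le_sum fun s _ => ?_
    rw [Real.cosh_eq]
    linarith [Real.exp_pos (-b s)]
  have h3 : Real.exp (1 / t * ∑ s ∈ Finset.range t, b s) < c :=
    calc _ ≤ 1 / t * (2 * ∑ s ∈ Finset.range t, Real.cosh (b s)) := h1.trans (by gcongr)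
      _ < 1 / t * (2 * (t * (c / 2))) := by gcongr
      _ = c := by field_simp
  rw [← Real.lt_log_iff_exp_lt hc, one_div, inv_mul_lt_iff₀ ht'] at h3
  exact h3

/-- The distance of the iterates to gradient descent on the risk, for at most `n / 16` passes. -/
theorem BoundedData.prob_iterate_sub_riskDescent_le (h : BoundedData ρ M κ) {γ : ℝ} (hγ : 0 < γ)
    (hγκ : γ * κ ≤ 1) {n t : ℕ} (ht : 0 < t) (hnt : 16 * t ≤ n) {Z : Fin n → Ω → H × ℝ}
    (hZ : ∀ i, Measurable (Z i)) (hlaw : ∀ i, P.map (Z i) = ρ) (hind : iIndepFun Z P)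
    {δ : ℝ} (hδ : 0 < δ) :
    1 - δ < P.real {ω | ‖iterate γ (fun i => Z i ω) 0 t - riskDescent ρ (γ / n) (n * t)‖ ≤
      γ * √κ * M * (Real.log (16 / δ) / √n) * t} := by
  have hn : 0 < n := by omega
  have hn' : (0 : ℝ) < n := Nat.cast_pos.2 hn
  have ht' : (0 : ℝ) < t := Nat.cast_pos.2 ht
  have hn1 : (1 : ℝ) ≤ n := by exact_mod_cast hn
  have hκ := h.κ_pos
  have hM := h.M_pos
  have hsκ : 0 < √κ := Real.sqrt_pos.2 hκ
  have hsn : 0 < √(n : ℝ) := Real.sqrt_pos.2 hn'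
  have hηκ : γ / n * κ ≤ 1 := by
    rw [div_mul_eq_mul_div, div_le_one hn']; linarith
  set c : ℝ := √n / (γ * √κ * M) with hc
  have hc0 : 0 < c := by positivity
  let A : H × ℝ → H →L[ℝ] H := fun z => stepLinear (γ / n) (truncate M κ z).1
  let ξ : ℕ → Fin n → H × ℝ → H := fun s i z => c • gradNoise ρ M κ (γ / n) (n * s + i) z
  let Y : (Fin n → H × ℝ) → ℝ := fun z =>
    ∑ s ∈ Finset.range t, Real.cosh ‖affineFold A (ξ s) z 0‖
  have hpass : ∀ s ∈ Finset.range t, (∀ i z, ‖ξ s i z‖ ≤ 1) ∧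
      ∫ z, Real.cosh ‖affineFold A (ξ s) z 0‖ ∂(Measure.pi fun _ : Fin n => ρ) ≤ Real.exp 1 :=
    fun s hs => h.integral_cosh_pass_le hγ hγκ ht hnt (by
      rw [← mul_add_one]
      exact Nat.mul_le_mul_left _ (Finset.mem_range.1 hs))
  have hint : ∀ s ∈ Finset.range t, Integrable (fun z => Real.cosh ‖affineFold A (ξ s) z 0‖)
      (Measure.pi fun _ : Fin n => ρ) := fun s hs =>
    integrable_cosh_norm_affineFold
      (fun z => norm_stepLinear_le (by positivity) hηκ (truncate_bound hM.le hκ.le z).2)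
      (measurable_stepLinear_truncate M κ (γ / n))
      (fun i => (measurable_gradNoise ρ M κ (γ / n) (n * s + i)).const_smul c) (hpass s hs).1 _
  have hYint : Integrable Y (Measure.pi fun _ : Fin n => ρ) := integrable_finsetSum _ hint
  have hYle : ∫ z, Y z ∂(Measure.pi fun _ : Fin n => ρ) ≤ t * Real.exp 1 := by
    simp only [Y]
    rw [integral_finsetSum _ hint]
    refine (Finset.sum_le_sum fun s hs => (hpass s hs).2).trans ?_
    simp
  have hY0 : ∀ z, 0 ≤ Y z := fun z => Finset.sum_nonneg fun s _ => (Real.cosh_pos _).le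
  have hmap : P.map (fun ω i => Z i ω) = Measure.pi fun _ : Fin n => ρ := by
    rw [(iIndepFun_iff_map_fun_eq_pi_map fun i => (hZ i).aemeasurable).1 hind]
    simp_rw [hlaw]
  have hZm : Measurable fun ω i => Z i ω := measurable_pi_lambda _ hZ
  have hYm : Measurable Y := Finset.measurable_sum _ fun s _ =>
    Real.continuous_cosh.measurable.comp
      ((measurable_affineFold (measurable_stepLinear_truncate M κ (γ / n)) fun i =>
        (measurable_gradNoise ρ M κ (γ / n) (n * s + i)).const_smul c).comp
          (measurable_id.prodMk measurable_const)).norm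
  -- Markov's inequality for the exponential moment
  have hmarkov : (Measure.pi fun _ : Fin n => ρ).real {z | t * (16 / δ / 2) ≤ Y z} < δ := by
    have h1 := (mul_meas_ge_le_integral_of_nonneg (.of_forall hY0) hYint
      (t * (16 / δ / 2))).trans hYle
    set p := (Measure.pi fun _ : Fin n => ρ).real {z | t * (16 / δ / 2) ≤ Y z}
    have h2 : t * (8 / δ * p) ≤ t * Real.exp 1 := by
      refine le_trans (le_of_eq ?_) h1; ring
    have h3 : 8 / δ * p ≤ Real.exp 1 := le_of_mul_le_mul_left h2 ht'
    have h4 : 8 * p ≤ Real.exp 1 * δ := by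
      rwa [div_mul_eq_mul_div, div_le_iff₀ hδ] at h3
    nlinarith [Real.exp_one_lt_d9]
  have hprob : 1 - δ < P.real {ω | Y (fun i => Z i ω) < t * (16 / δ / 2)} := by
    have h1 : P.real ((fun ω i => Z i ω) ⁻¹' {z | Y z < t * (16 / δ / 2)})
        = (Measure.pi fun _ : Fin n => ρ).real {z | Y z < t * (16 / δ / 2)} := by
      rw [← hmap, map_measureReal_apply hZm (measurableSet_lt hYm measurable_const)]
    have h2 : {z | Y z < t * (16 / δ / 2)} = {z | t * (16 / δ / 2) ≤ Y z}ᶜ := by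
      ext z; simp
    rw [h2, probReal_compl_eq_one_sub (measurableSet_le measurable_const hYm), ← h2] at h1
    refine lt_of_lt_of_eq ?_ h1.symm
    linarith
  refine hprob.trans_le (ENNReal.toReal_mono (measure_ne_top _ _) (measure_mono_ae ?_))
  filter_upwards [h.ae_sample_bound hZ hlaw] with ω hω hYω
  have h1 := sum_lt_of_sum_cosh_lt ht (fun s => ‖affineFold A (ξ s) (fun i => Z i ω) 0‖)
    (by positivity) hYω
  have h2 : ∀ s, ‖affineFold A (ξ s) (fun i => Z i ω) 0‖
      = c * ‖gradPass (γ / n) (fun i => Z i ω) (riskDescent ρ (γ / n) (n * s))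
        - riskDescent ρ (γ / n) (n * s + n)‖ := fun s => by
    rw [affineFold_gradNoise ρ M κ (γ / n) c (n * s) hω, norm_smul, Real.norm_of_nonneg hc0.le]
  simp only [h2] at h1
  rw [← Finset.mul_sum] at h1
  refine (norm_iterate_sub_riskDescent_le ρ hγ.le hηκ (fun i => (hω i).2) t).trans ?_
  refine le_of_mul_le_mul_left (h1.le.trans (le_of_eq ?_)) hc0
  rw [hc]
  field_simp

theorem one_le_log_sixteen_div {δ : ℝ} (hδ : 0 < δ) (hδ1 : δ < 1) : 1 ≤ Real.log (16 / δ) := by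
  rw [Real.le_log_iff_exp_le (by positivity), le_div_iff₀ hδ]
  nlinarith [Real.exp_one_lt_d9]

/-- The distance of the iterates to gradient descent on the risk, for any number of passes. When
the number of passes exceeds `n / 16`, both points are so close to the origin that the bound holds
almost surely. -/
theorem BoundedData.prob_variance_le (h : BoundedData ρ M κ) {γ : ℝ} (hγ : 0 < γ)
    (hγκ : γ * κ ≤ 1) {n t : ℕ} (hn : 0 < n) (ht : 0 < t) {Z : Fin n → Ω → H × ℝ}
    (hZ : ∀ i, Measurable (Z i)) (hlaw : ∀ i, P.map (Z i) = ρ) (hind : iIndepFun Z P)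
    {δ : ℝ} (hδ : 0 < δ) (hδ1 : δ < 1) :
    1 - δ < P.real {ω | ‖iterate γ (fun i => Z i ω) 0 t - riskDescent ρ (γ / n) (n * t)‖ ≤
      16 * Real.log (16 / δ) / √n * (M * κ ^ (-(1 / 2) : ℝ)) * t} := by
  have hn' : (0 : ℝ) < n := Nat.cast_pos.2 hn
  have hn1 : (1 : ℝ) ≤ n := by exact_mod_cast hn
  have ht1 : (1 : ℝ) ≤ t := by exact_mod_cast ht
  have hM := h.M_pos
  have hκ := h.κ_pos
  have hB := mul_sqrt_le_rpow_neg_half hκ hγκ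
  have hlog := one_le_log_sixteen_div hδ hδ1
  have hsn : 0 < √(n : ℝ) := Real.sqrt_pos.2 hn'
  rcases le_or_gt (16 * t) n with hnt | hnt
  · refine (h.prob_iterate_sub_riskDescent_le hγ hγκ ht hnt hZ hlaw hind hδ).trans_le
      (measureReal_mono (Set.ofPred_subset_ofPred.2 fun ω hω => hω.trans ?_))
    have h1 : γ * √κ * M * (Real.log (16 / δ) / √n)
        ≤ κ ^ (-(1 / 2) : ℝ) * M * (16 * Real.log (16 / δ) / √n) := by
      gcongr; linarith
    refine mul_le_mul_of_nonneg_right (h1.trans (le_of_eq ?_)) (by positivity)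
    ring
  · have hηκ : γ / n * κ ≤ 1 := by
      rw [div_mul_eq_mul_div, div_le_one hn']; linarith
    have hγκ' : √γ ≤ κ ^ (-(1 / 2) : ℝ) := by
      rw [Real.rpow_neg hκ.le, ← Real.sqrt_eq_rpow, ← Real.sqrt_inv]
      exact Real.sqrt_le_sqrt (by rwa [← one_div, le_div_iff₀ hκ])
    have hae : ∀ᵐ ω ∂P, ‖iterate γ (fun i => Z i ω) 0 t - riskDescent ρ (γ / n) (n * t)‖ ≤
        16 * Real.log (16 / δ) / √n * (M * κ ^ (-(1 / 2) : ℝ)) * t := by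
      filter_upwards [h.ae_sample_bound hZ hlaw] with ω hω
      have e1 : ‖iterate γ (fun i => Z i ω) 0 t‖ ≤ √(γ * t * M ^ 2) :=
        Real.le_sqrt_of_sq_le (norm_sq_iterate_le hγ.le hηκ hn hω t)
      have e2 : ‖riskDescent ρ (γ / n) (n * t)‖ ≤ √(γ * t * M ^ 2) := by
        refine Real.le_sqrt_of_sq_le
          ((h.norm_sq_riskDescent_le (by positivity) hηκ _).trans (le_of_eq ?_))
        push_cast
        field_simp
      have e3 : √(γ * t * M ^ 2) = √γ * √t * M := by
        rw [Real.sqrt_mul (by positivity), Real.sqrt_mul hγ.le, Real.sqrt_sq hM.le]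
      have e4 : √(n : ℝ) ≤ 4 * √(t : ℝ) := by
        refine (Real.sqrt_le_left (by positivity)).2 ?_
        rw [mul_pow, Real.sq_sqrt (by positivity)]
        norm_num
        exact_mod_cast hnt.le
      have e5 : 2 * √(t : ℝ) ≤ 16 * Real.log (16 / δ) / √n * t := by
        rw [div_mul_eq_mul_div, le_div_iff₀ hsn]
        have e6 : √(t : ℝ) * √(t : ℝ) = t := Real.mul_self_sqrt (by positivity)
        calc 2 * √(t : ℝ) * √n ≤ 2 * √(t : ℝ) * (4 * √(t : ℝ)) := by gcongr
          _ = 8 * (√(t : ℝ) * √(t : ℝ)) := by ring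
          _ = 8 * t := by rw [e6]
          _ ≤ _ := by nlinarith
      calc _ ≤ √γ * √t * M + √γ * √t * M := by
            rw [← e3]; exact (norm_sub_le _ _).trans (add_le_add e1 e2)
        _ = (2 * √t) * (M * √γ) := by ring
        _ ≤ (16 * Real.log (16 / δ) / √n * t) * (M * κ ^ (-(1 / 2) : ℝ)) := by gcongr
        _ = _ := by ring
    refine lt_of_lt_of_le (show 1 - δ < P.real Set.univ by simp [hδ])
      (ENNReal.toReal_mono (measure_ne_top _ _) (measure_mono_ae ?_))
    filter_upwards [hae] with ω hω _ using hω

end HighProbability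

end IncReg

theorem theorem2
    {H : Type*} [NormedAddCommGroup H] [InnerProductSpace ℝ H] [CompleteSpace H]
    [SecondCountableTopology H] [MeasurableSpace H] [BorelSpace H]
    (ρ : Measure (H × ℝ)) [IsProbabilityMeasure ρ]
    (M κ : ℝ) (hρ : IncReg.BoundedData ρ M κ)
    (γ : ℝ) (hγ : 0 < γ) (hγκ : γ ≤ κ⁻¹)
    (r : ℝ) (hr : 1 / 2 < r) (g : Lp ℝ 2 ρ.fst) (hg : IncReg.SourceCondition hρ r g) :
    (IncReg.riskMinimizers ρ).Nonempty ∧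
    (∃! w : H, IncReg.IsMinNormMinimizer ρ w) ∧
    ∀ wdag : H, IncReg.IsMinNormMinimizer ρ wdag →
      ∀ (n : ℕ), 0 < n →
      ∀ (Ω : Type*) [MeasurableSpace Ω] (P : Measure Ω) [IsProbabilityMeasure P]
        (Z : Fin n → Ω → H × ℝ), (∀ i, Measurable (Z i)) → (∀ i, P.map (Z i) = ρ) →
        iIndepFun Z P →
      ∀ δ : ℝ, 0 < δ → δ < 1 →
        (∀ t : ℕ, 0 < t →
          1 - δ < P.real {ω | ‖IncReg.iterate γ (fun i => Z i ω) 0 t - wdag‖ ≤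
            32 * Real.log (16 / δ) / √(n : ℝ) *
                (M * κ ^ (-(1 / 2) : ℝ) + 2 * M ^ 2 * κ⁻¹ + 3 * ‖g‖ * κ ^ (r - 3 / 2)) * (t : ℝ)
              + ((r - 1 / 2) / γ) ^ (r - 1 / 2) * ‖g‖ * (t : ℝ) ^ (1 / 2 - r)}) ∧
        1 - δ < P.real
          {ω | ‖IncReg.iterate γ (fun i => Z i ω) 0 ⌈(n : ℝ) ^ (1 / (2 * r + 1))⌉₊ - wdag‖ ≤
            (32 * Real.log (16 / δ) *
                (M * κ ^ (-(1 / 2) : ℝ) + 2 * M ^ 2 * κ⁻¹ + 3 * ‖g‖ * κ ^ (r - 3 / 2))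
              + ((r - 1 / 2) / γ) ^ (r - 1 / 2) * ‖g‖) *
              (n : ℝ) ^ (-((r - 1 / 2) / (2 * r + 1)))} := by
  obtain ⟨w₀, hw₀, hrate⟩ := hg.exists_minNormMinimizer hr
  refine ⟨⟨w₀, ((hw₀ w₀).2 rfl).1⟩, ⟨w₀, (hw₀ w₀).2 rfl, fun w hw => (hw₀ w).1 hw⟩, ?_⟩
  intro wdag hwdag n hn Ω _ P _ Z hZ hlaw hind δ hδ hδ1
  obtain rfl := (hw₀ wdag).1 hwdag
  have hκ := hρ.κ_pos
  have hM := hρ.M_pos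
  have hγκ' : γ * κ ≤ 1 := by rwa [← le_div_iff₀ hκ, one_div]
  have hn' : (0 : ℝ) < n := Nat.cast_pos.2 hn
  have hn1 : (1 : ℝ) ≤ n := by exact_mod_cast hn
  have hηκ : γ / n * κ ≤ 1 := by
    rw [div_mul_eq_mul_div, div_le_one hn']; linarith
  have hlog := IncReg.one_le_log_sixteen_div hδ hδ1
  have hp : 0 < r - 1 / 2 := by linarith
  set C := M * κ ^ (-(1 / 2) : ℝ) + 2 * M ^ 2 * κ⁻¹ + 3 * ‖g‖ * κ ^ (r - 3 / 2)
  have hC : M * κ ^ (-(1 / 2) : ℝ) ≤ C := by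
    have h1 : 0 ≤ 2 * M ^ 2 * κ⁻¹ := by positivity
    have h2 : 0 ≤ 3 * ‖g‖ * κ ^ (r - 3 / 2) := by positivity
    simp only [C]
    linarith
  have hC0 : 0 ≤ C := le_trans (by positivity) hC
  have hbias : ∀ t : ℕ, 0 < t → ‖IncReg.riskDescent ρ (γ / n) (n * t) - wdag‖ ≤
      ((r - 1 / 2) / γ) ^ (r - 1 / 2) * ‖g‖ * (t : ℝ) ^ (1 / 2 - r) := fun t ht => by
    have ht' : (0 : ℝ) < t := Nat.cast_pos.2 ht
    refine (hrate (γ / n) (by positivity) hηκ (n * t) (Nat.mul_pos hn ht)).trans (le_of_eq ?_)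
    have h1 : (r - 1 / 2) / (γ / n * ((n * t : ℕ) : ℝ)) = (r - 1 / 2) / γ * (t : ℝ)⁻¹ := by
      push_cast
      field_simp
    rw [h1, Real.mul_rpow (by positivity) (by positivity), Real.inv_rpow ht'.le,
      ← Real.rpow_neg ht'.le, neg_sub]
    ring
  -- half of the constant of the fixed-time bound leaves room for rounding up the stopping time
  have main : ∀ t : ℕ, 0 < t → ∀ K : ℝ,
      16 * Real.log (16 / δ) / √(n : ℝ) * C * t
        + ((r - 1 / 2) / γ) ^ (r - 1 / 2) * ‖g‖ * (t : ℝ) ^ (1 / 2 - r) ≤ K →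
      1 - δ < P.real {ω | ‖IncReg.iterate γ (fun i => Z i ω) 0 t - wdag‖ ≤ K} :=
    fun t ht K hK => by
      refine (hρ.prob_variance_le hγ hγκ' hn ht hZ hlaw hind hδ hδ1).trans_le
        (measureReal_mono fun ω hω => ?_)
      refine (norm_sub_le_norm_sub_add_norm_sub _ (IncReg.riskDescent ρ (γ / n) (n * t)) _).trans
        (le_trans (add_le_add (le_trans hω ?_) (hbias t ht)) hK)
      gcongr
  refine ⟨fun t ht => main t ht _ ?_, ?_⟩
  · gcongr
    norm_num
  · set s : ℝ := (n : ℝ) ^ (1 / (2 * r + 1)) with hs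
    have hs1 : 1 ≤ s := Real.one_le_rpow hn1 (by positivity)
    have ht1 : 0 < ⌈s⌉₊ := Nat.ceil_pos.2 (by linarith)
    refine main _ ht1 _ ?_
    have h1 : (⌈s⌉₊ : ℝ) ≤ 2 * s := (Nat.ceil_lt_add_one (by linarith)).le.trans (by linarith)
    have h2 : s / √(n : ℝ) = (n : ℝ) ^ (-((r - 1 / 2) / (2 * r + 1))) := by
      rw [hs, Real.sqrt_eq_rpow, ← Real.rpow_sub hn']
      congr 1
      field_simp
      ring
    have h3 : (⌈s⌉₊ : ℝ) ^ (1 / 2 - r) ≤ (n : ℝ) ^ (-((r - 1 / 2) / (2 * r + 1))) := by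
      refine (Real.rpow_le_rpow_of_nonpos (by linarith) (Nat.le_ceil s) (by linarith)).trans
        (le_of_eq ?_)
      rw [hs, ← Real.rpow_mul hn'.le]
      congr 1
      ring
    rw [add_mul]
    refine add_le_add ?_ (by gcongr)
    calc 16 * Real.log (16 / δ) / √(n : ℝ) * C * ⌈s⌉₊
        ≤ 16 * Real.log (16 / δ) / √(n : ℝ) * C * (2 * s) := by gcongr
      _ = 32 * Real.log (16 / δ) * C * (s / √(n : ℝ)) := by ring
      _ = _ := by rw [h2]
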